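/- Let $d\ge 1$ be an integer and $\mathbb T=\mathbb R/\mathbb Z$ (with normalised measure). For an integer $N\ge 1$ let $S_{d,N}=\{\mathbf n=(n_1,\dots,n_d)\in\mathbb Z^d: |n_j|\le N,\ 1\le j\le d\}$ and $|\mathbf n|^2=n_1^2+\cdots+n_d^2$. For $p>1$ let $K_{p,d,N}$ be the best constant such that $$\Big\|\sum_{\mathbf n\in S_{d,N}}a_{\mathbf n}e^{2\pi i(\mathbf n\cdot\mathbf x+|\mathbf n|^2t)}\Big\|_{L^p(\mathbb T^{d+1})}\le K_{p,d,N}\Big(\sum_{\mathbf n\in S_{d,N}}|a_{\mathbf n}|^2\Big)^{1/2}$$ for all complex numbers $a_{\mathbf n}$, and let $A_{p,d,N}$ be the best constant such that $$\sum_{\mathbf n\in S_{d,N}}\big|\widehat f(\mathbf n,|\mathbf n|^2)\big|^2\le A_{p,d,N}\|f\|_{L^{p'}(\mathbb T^{d+1})}^2$$ for all $f\in L^{p'}(\mathbb T^{d+1})$, where $p'=p/(p-1)$ and $\widehat f$ denotes the Fourier coefficients of $f$. For every $\varepsilon>0$ there is a constant $C_\varepsilon$, depending only on $d$ and $\varepsilon$,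 such that for every real $p>\frac{2(d+4)}{d}$ and every integer $N\ge 1$, $$K_{p,d,N}\le C_\varepsilon N^{\frac d2-\frac{d+2}{p}+\varepsilon}.$$ Likewise, for every $\varepsilon>0$ there is a constant $C'_\varepsilon$, depending only on $d$ and $\varepsilon$, such that for every real $p>\frac{2(d+4)}{d}$ and every integer $N\ge 1$, $$A_{p,d,N}\le C'_\varepsilon N^{d-\frac{2(d+2)}{p}+\varepsilon}.$$ -/

import Mathlib

open MeasureTheory
open scoped ENNReal

noncomputable section

/-- The box `S_{d,N}` of all `n ∈ ℤᵈ` with `|n_j| ≤ N` for every `j`. -/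
def freqBox (d N : ℕ) : Finset (Fin d → ℤ) :=
  Fintype.piFinset fun _ => Finset.Icc (-(N : ℤ)) (N : ℤ)

/-- The lattice point `(n, |n|²) ∈ ℤᵈ⁺¹` of the paraboloid lying above `n ∈ ℤᵈ`. -/
def paraboloidPoint {d : ℕ} (n : Fin d → ℤ) : Fin (d + 1) → ℤ :=
  Fin.snoc (α := fun _ => ℤ) n (∑ j, n j ^ 2)

/-- Normalised Haar (Lebesgue) measure, of total mass one, on `𝕋ᵈ⁺¹ = (ℝ/ℤ)ᵈ⁺¹`. -/
def torusMeasure (d : ℕ) : Measure (UnitAddTorus (Fin (d + 1))) :=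
  Measure.pi fun _ => AddCircle.haarAddCircle

/-- The exponential sum `∑_{n ∈ S_{d,N}} a_n e^{2πi(n·x + |n|²t)}` as a function of the point
`z = (x, t)` of the torus `𝕋ᵈ⁺¹ = (ℝ/ℤ)ᵈ⁺¹` (the last coordinate of `z` is `t`). -/
def strichartzSum (d N : ℕ) (a : (Fin d → ℤ) → ℂ) (z : UnitAddTorus (Fin (d + 1))) : ℂ :=
  ∑ n ∈ freqBox d N, a n * UnitAddTorus.mFourier (paraboloidPoint n) z

/-- The periodic Strichartz constant `K_{p,d,N}`: the best (smallest) constant `K` with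
`‖∑_{n ∈ S_{d,N}} a_n e^{2πi(n·x + |n|²t)}‖_{Lᵖ(𝕋ᵈ⁺¹)} ≤ K (∑_{n ∈ S_{d,N}} |a_n|²)^{1/2}` for all
complex `a_n`. Values are in `[0, ∞]`, so that the infimum is `∞` if there is no finite constant. -/
def strichartzConst (p : ℝ) (d N : ℕ) : ℝ≥0∞ :=
  sInf {K : ℝ≥0∞ | ∀ a : (Fin d → ℤ) → ℂ,
    eLpNorm (strichartzSum d N a) (ENNReal.ofReal p) (torusMeasure d)
      ≤ K * (∑ n ∈ freqBox d N, ‖a n‖ₑ ^ 2) ^ (1 / 2 : ℝ)}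

/-- The discrete restriction constant `A_{p,d,N}`: the best (smallest) constant `A` with
`∑_{n ∈ S_{d,N}} |f̂(n, |n|²)|² ≤ A ‖f‖²_{Lᵖ'(𝕋ᵈ⁺¹)}` for all `f ∈ Lᵖ'(𝕋ᵈ⁺¹)`, `p' = p/(p-1)`. -/
def restrictionConst (p : ℝ) (d N : ℕ) : ℝ≥0∞ :=
  sInf {A : ℝ≥0∞ | ∀ f : UnitAddTorus (Fin (d + 1)) → ℂ,
    MemLp f (ENNReal.ofReal (p / (p - 1))) (torusMeasure d) →
      ∑ n ∈ freqBox d N, ‖UnitAddTorus.mFourierCoeff f (paraboloidPoint n)‖ₑ ^ 2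
        ≤ A * eLpNorm f (ENNReal.ofReal (p / (p - 1))) (torusMeasure d) ^ 2}

end

/-! The work is done on a finite grid `G = (ℤ/M)ᵈ × ℤ/M`. If coefficients of ℓ² norm at most 1 give
a sum of size at least λ on `E ⊆ G`, duality yields `|u| ≤ 1` on `E` with `λ²|E|² ≤ ∑ₙ |∑_E u χₙ|²`
(`AddChar.sq_mul_card_sq_le`). The right side is a quadratic form with convolution kernel `K = ∑ₙ
χₙ`.

`K` may be large, so it is replaced by `KΦ`, where Φ is the indicator in the time variable of arcs
of length `J/M = 1/(16Q²)` to the right of the fractions a/q, with q prime in `[Q^{1-δ}, Q]` and `Q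
≥ N`. On these arcs Weyl's inequality gives `|K| ≲ Q^{d/2+}`. Expanding Φ in characters of t, the
zero frequency returns `K` with weight about `Q²J`, up to small powers of Q, while every other
weight is `O(QJ)` (`norm_dft_arcIndicator_le`). The time-modulated copies of `K` consist of pairwise
distinct characters, so Bessel controls all of them at once (`AddChar.dft_zero_mul_sum_norm_sq_le`).
Hence `λ²|E| ≲ Q^{d/2+}|E| + Q^{-1+}|G|`, and the first term is absorbed once `λ² ≥ C Q^{d/2+}`
(`exists_sq_mul_card_le`).

Since Q is free, it is tied to the level by `λ² ≈ Q^{d/2}`, and runs dyadically from N to about N²,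
where Cauchy–Schwarz leaves no larger values. At `p₀ = 2(d+4)/d` the level Q contributes about
`λ^{p₀-2} Q⁻¹ ≈ Q`, so the top level gives N²; values below the level `Q = N` also give N², by the
L² bound. This is the expected power, because `dp₀/2 - (d+2) = 2`. Larger p follow from the supremum
bound, with a constant independent of p. Averaging over translates of the grid passes to the torus,
and Hölder duality gives `A ≤ K²` for the two constants. -/

/-! ### Weyl sums near fractions with prime denominator. -/

/-- Telescoping of a geometric sum; the product form avoids excluding `ψ z = 1`. -/
theorem AddChar.norm_sum_Icc_mul_norm_sub_one_le {R : Type*} [CommRing R] (ψ : AddChar R ℂ)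
    (hψ : ∀ x, ‖ψ x‖ = 1) (z : R) (u v : ℤ) :
    ‖∑ m ∈ Finset.Icc u v, ψ ((m : R) * z)‖ * ‖ψ z - 1‖ ≤ 2 := by
  rcases lt_or_ge v u with h | h
  · simp [Finset.Icc_eq_empty_of_lt h]
  have key : (∑ m ∈ Finset.Icc u v, ψ ((m : R) * z)) * (ψ z - 1)
      = ψ (((v + 1 : ℤ) : R) * z) - ψ ((u : R) * z) := by
    induction v, h using Int.leInduction with
    | base =>
      rw [Finset.Icc_self, Finset.sum_singleton, mul_sub, ← AddChar.map_add_eq_mul, mul_one]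
      congr 2
      push_cast
      ring
    | succ v hv ih =>
      have : Finset.Icc u (v + 1) = insert (v + 1) (Finset.Icc u v) := by
        ext x
        simp only [Finset.mem_Icc, Finset.mem_insert]
        omega
      rw [this, Finset.sum_insert (by simp), add_mul, ih, mul_sub, ← AddChar.map_add_eq_mul,
        mul_one]
      have e : (((v + 1 : ℤ) : R) * z + z) = ((v + 1 + 1 : ℤ) : R) * z := by
        push_cast
        ring
      rw [e]
      ring
  rw [← norm_mul, key]
  calc _ ≤ ‖ψ (((v + 1 : ℤ) : R) * z)‖ + ‖ψ ((u : R) * z)‖ := norm_sub_le _ _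
    _ = 2 := by rw [hψ, hψ]; norm_num

/-- Weyl differencing for quadratic exponential sums over a symmetric interval. -/
theorem AddChar.norm_sum_quadratic_sq_le {R : Type*} [CommRing R] (ψ : AddChar R ℂ)
    (hψ : ∀ x, ‖ψ x‖ = 1) (x t : R) (N : ℕ) :
    ‖∑ n ∈ Finset.Icc (-(N : ℤ)) N, ψ ((n : R) * x + (n : R) ^ 2 * t)‖ ^ 2
      ≤ ∑ h ∈ Finset.Icc (-(2 * N : ℤ)) (2 * N),
        ‖∑ m ∈ Finset.Icc (max (-(N : ℤ)) (-N - h)) (min (N : ℤ) (N - h)),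
          ψ ((m : R) * (2 * (h : R) * t))‖ := by
  have hconj : ∀ y, (starRingEnd ℂ) (ψ y) = ψ (-y) := fun y => by
    rw [AddChar.map_neg_eq_inv, Complex.inv_def, Complex.normSq_eq_norm_sq, hψ]
    simp
  set W := ∑ n ∈ Finset.Icc (-(N : ℤ)) N, ψ ((n : R) * x + (n : R) ^ 2 * t) with hW
  -- Substituting `n = m + h`, the phase difference is `hx + h²t + 2mht`: for fixed `h` only the
  -- last term depends on `m`, and it is linear in `m`.
  have h1 : ((‖W‖ ^ 2 : ℝ) : ℂ) = ∑ h ∈ Finset.Icc (-(2 * N : ℤ)) (2 * N),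
      ψ ((h : R) * x + (h : R) ^ 2 * t) *
        ∑ m ∈ Finset.Icc (max (-(N : ℤ)) (-N - h)) (min (N : ℤ) (N - h)),
          ψ ((m : R) * (2 * (h : R) * t)) := by
    have : ((‖W‖ ^ 2 : ℝ) : ℂ) = (starRingEnd ℂ) W * W := by
      rw [mul_comm, Complex.mul_conj, Complex.normSq_eq_norm_sq]
    rw [this]
    conv_lhs => rw [hW, map_sum, Finset.sum_mul_sum]
    simp_rw [hconj, ← AddChar.map_add_eq_mul, Finset.mul_sum, ← AddChar.map_add_eq_mul]
    have step : ∀ m ∈ Finset.Icc (-(N : ℤ)) N,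
        ∑ n ∈ Finset.Icc (-(N : ℤ)) N,
          ψ (-((m : R) * x + (m : R) ^ 2 * t) + ((n : R) * x + (n : R) ^ 2 * t))
        = ∑ h ∈ Finset.Icc (-(N : ℤ) - m) (N - m),
          ψ ((h : R) * x + (h : R) ^ 2 * t + (m : R) * (2 * (h : R) * t)) := by
      intro m _
      refine Finset.sum_nbij' (fun n => n - m) (fun h => h + m) ?_ ?_ ?_ ?_ ?_
      · intro n hn; simp only [Finset.mem_Icc] at hn ⊢; omega
      · intro n hn; simp only [Finset.mem_Icc] at hn ⊢; omega
      · intro n _; simp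
      · intro n _; simp
      · intro n _
        congr 1
        push_cast
        ring
    rw [Finset.sum_congr rfl step]
    refine Finset.sum_comm' ?_
    intro m h
    simp only [Finset.mem_Icc]
    omega
  have h2 : ‖W‖ ^ 2 = ‖((‖W‖ ^ 2 : ℝ) : ℂ)‖ := by
    rw [Complex.norm_real, Real.norm_of_nonneg (by positivity)]
  rw [h2, h1]
  refine (norm_sum_le _ _).trans (le_of_eq ?_)
  refine Finset.sum_congr rfl fun h _ => ?_
  rw [norm_mul, hψ, one_mul]

theorem Int.card_Icc_filter_intCast_eq_le (q : ℕ) (hq : 0 < q) (s : ZMod q) (H : ℕ) :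
    (((Finset.Icc (-(H : ℤ)) H).filter fun h : ℤ => (h : ZMod q) = s).card : ℝ)
      ≤ (2 * H + 1) / q + 1 := by
  have : NeZero q := ⟨hq.ne'⟩
  have hs : ∀ h : ℤ, (h : ZMod q) = s ↔ h ≡ (s.val : ℤ) [ZMOD q] := by
    intro h
    rw [← ZMod.intCast_eq_intCast_iff]
    simp
  have hI : Finset.Icc (-(H : ℤ)) H = Finset.Ioc (-(H : ℤ) - 1) H := by
    ext x; simp only [Finset.mem_Icc, Finset.mem_Ioc]; omega
  simp_rw [hs]
  rw [hI]
  have h := Int.Ioc_filter_modEq_card (-(H : ℤ) - 1) H (r := (q : ℤ)) (by exact_mod_cast hq)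
    (s.val : ℤ)
  have h' : (((Finset.Ioc (-(H : ℤ) - 1) H).filter fun h => h ≡ (s.val : ℤ) [ZMOD q]).card : ℝ)
    = ((max (⌊((H : ℤ) - (s.val : ℤ) : ℚ) / ((q : ℤ) : ℚ)⌋ -
        ⌊((-(H : ℤ) - 1 : ℤ) - (s.val : ℤ) : ℚ) / ((q : ℤ) : ℚ)⌋) 0 : ℤ) : ℝ) := by
    exact_mod_cast congrArg (fun z : ℤ => (z : ℝ)) h
  rw [h']
  push_cast
  have hq' : (0 : ℝ) < q := by exact_mod_cast hq
  refine max_le ?_ (by positivity)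
  have a1 := Int.floor_le (((H : ℚ) - (s.val : ℚ)) / (q : ℚ))
  have a2 := Int.lt_floor_add_one ((-(H : ℚ) - 1 - (s.val : ℚ)) / (q : ℚ))
  have a3 : ((H : ℚ) - (s.val : ℚ)) / (q : ℚ) - (-(H : ℚ) - 1 - (s.val : ℚ)) / (q : ℚ)
      = (2 * H + 1) / q := by ring
  generalize ⌊((H : ℚ) - (s.val : ℚ)) / (q : ℚ)⌋ = A at a1 ⊢
  generalize ⌊(-(H : ℚ) - 1 - (s.val : ℚ)) / (q : ℚ)⌋ = B at a2 ⊢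
  have a4 : (A : ℚ) - B ≤ (2 * H + 1) / q + 1 := by linarith
  have a5 := (Rat.cast_le (K := ℝ)).2 a4
  push_cast at a5
  exact a5

/-- Multiplication by the unit `u` permutes residues, and each residue class meets the interval at
most `(2H+1)/q + 1` times. -/
theorem ZMod.sum_mul_intCast_le (q : ℕ) [Fact q.Prime] (u : ZMod q) (hu : u ≠ 0)
    (g : ZMod q → ℝ) (hg : ∀ r, 0 ≤ g r) (H : ℕ) :
    ∑ h ∈ Finset.Icc (-(H : ℤ)) H, g (u * (h : ZMod q)) ≤ ((2 * H + 1) / q + 1) * ∑ r, g r := by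
  rw [← Finset.sum_fiberwise (Finset.Icc (-(H : ℤ)) H) (fun h => u * (h : ZMod q)),
    Finset.mul_sum]
  refine Finset.sum_le_sum fun r _ => ?_
  rw [Finset.sum_congr rfl (g := fun _ => g r)
    (fun h hh => by rw [(Finset.mem_filter.1 hh).2]), Finset.sum_const, nsmul_eq_mul]
  refine mul_le_mul_of_nonneg_right ?_ (hg r)
  have : ∀ h : ℤ, u * (h : ZMod q) = r ↔ (h : ZMod q) = u⁻¹ * r := fun h => by
    rw [eq_inv_mul_iff_mul_eq₀ hu]
  simp_rw [this]
  exact Int.card_Icc_filter_intCast_eq_le q (Fact.out : q.Prime).pos _ H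

/-- The residue 0 contributes `1 / 0 = 0`, so this is a harmonic sum. -/
theorem ZMod.sum_one_div_val_le (q : ℕ) [NeZero q] :
    ∑ r : ZMod q, 1 / (r.val : ℝ) ≤ 1 + Real.log q := by
  have hq : 0 < q := NeZero.pos q
  have : ∑ r : ZMod q, 1 / (r.val : ℝ) = ∑ s ∈ Finset.range q, 1 / (s : ℝ) := by
    refine Finset.sum_nbij' (fun r => r.val) (fun s => (s : ZMod q)) ?_ ?_ ?_ ?_ ?_
    · intro r _; simpa using ZMod.val_lt r
    · simp
    · intro r _; simp
    · intro s hs; exact ZMod.val_cast_of_lt (by simpa using hs)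
    · simp
  rw [this]
  have h := harmonic_le_one_add_log q
  refine le_trans ?_ h
  obtain ⟨k, rfl⟩ : ∃ k, q = k + 1 := ⟨q - 1, by omega⟩
  rw [Finset.sum_range_succ', harmonic, Finset.sum_range_succ]
  push_cast
  simp only [one_div]
  have : (0 : ℝ) ≤ ((k : ℝ) + 1)⁻¹ := by positivity
  linarith

/-- Lower bound for the distance of `e(y)` to `1`. -/
theorem Complex.le_norm_exp_sub_one (y c : ℝ) (hc0 : 0 ≤ c) (hy0 : c ≤ y) (hy1 : c ≤ 1 - y) :
    4 * c ≤ ‖Complex.exp (2 * Real.pi * Complex.I * (y : ℂ)) - 1‖ := by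
  have e : (2 * Real.pi * Complex.I * (y : ℂ)) = Complex.I * ((2 * Real.pi * y : ℝ) : ℂ) := by
    push_cast; ring
  rw [e, Complex.norm_exp_I_mul_ofReal_sub_one]
  have hs : 2 * c ≤ Real.sin (Real.pi * y) := by
    have hpi := Real.pi_pos
    rcases le_total y (1 / 2) with h | h
    · have := Real.mul_le_sin (x := Real.pi * y) (by nlinarith) (by nlinarith)
      have e2 : 2 / Real.pi * (Real.pi * y) = 2 * y := by field_simp
      linarith
    · have := Real.mul_le_sin (x := Real.pi * (1 - y)) (by nlinarith) (by nlinarith)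
      have e2 : 2 / Real.pi * (Real.pi * (1 - y)) = 2 * (1 - y) := by field_simp
      have e3 : Real.sin (Real.pi * (1 - y)) = Real.sin (Real.pi * y) := by
        rw [← Real.sin_pi_sub]; congr 1; ring
      linarith
  have e4 : 2 * Real.pi * y / 2 = Real.pi * y := by ring
  rw [e4, Real.norm_eq_abs]
  refine le_trans ?_ (le_abs_self _)
  linarith

/-- Character values on an arc around a rational with prime denominator. -/
theorem ZMod.le_norm_stdAddChar_sub_one {M q : ℕ} [NeZero M] [Fact q.Prime] (hqM : q ∣ M)
    (a i Q H : ℕ) (hqQ : q ≤ Q) (hHQ : H ≤ 2 * Q) (hi : 16 * Q ^ 2 * i < M) (h : ℤ)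
    (hh : |h| ≤ H) (hr : ((2 * a * h : ℤ) : ZMod q) ≠ 0) :
    0 < ‖ZMod.stdAddChar (2 * (h : ZMod M) * ((a : ZMod M) * ((M / q : ℕ) : ZMod M) + (i : ZMod M))) - 1‖ ∧
    2 / ‖ZMod.stdAddChar (2 * (h : ZMod M) * ((a : ZMod M) * ((M / q : ℕ) : ZMod M) + (i : ZMod M))) - 1‖
      ≤ q * (1 / (((2 * a * h : ℤ) : ZMod q).val : ℝ)
        + 1 / ((-((2 * a * h : ℤ) : ZMod q)).val : ℝ)) := by
  have hq : q.Prime := Fact.out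
  have hq0 : (0 : ℝ) < q := by exact_mod_cast hq.pos
  have hM0 : (0 : ℝ) < M := by exact_mod_cast NeZero.pos M
  set r := ((2 * a * h : ℤ) : ZMod q) with hrdef
  have hrv : 0 < r.val := by
    rw [Nat.pos_iff_ne_zero]; simpa [ZMod.val_eq_zero] using hr
  have hrq : r.val < q := ZMod.val_lt r
  have : NeZero r := ⟨hr⟩
  have hneg : (-r).val = q - r.val := ZMod.val_neg_of_ne_zero r
  obtain ⟨k, hk⟩ : ∃ k : ℤ, 2 * a * h = q * k + r.val := by
    have : ((2 * a * h - r.val : ℤ) : ZMod q) = 0 := by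
      rw [Int.cast_sub, ← hrdef]; simp
    rw [ZMod.intCast_zmod_eq_zero_iff_dvd] at this
    obtain ⟨k, hk⟩ := this
    exact ⟨k, by linarith⟩
  obtain ⟨L, hL⟩ := hqM
  have hL' : M / q = L := by rw [hL]; exact Nat.mul_div_cancel_left _ hq.pos
  rw [hL']
  have hML : (M : ℝ) = q * L := by exact_mod_cast hL
  have hL0 : (L : ℝ) ≠ 0 := by rintro h; rw [h, mul_zero] at hML; exact hM0.ne' hML
  set y : ℝ := r.val / q + 2 * h * i / M with hy
  have hchar : ZMod.stdAddChar (2 * (h : ZMod M) * ((a : ZMod M) * (L : ZMod M) + (i : ZMod M)))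
      = Complex.exp (2 * Real.pi * Complex.I * (y : ℂ)) := by
    have e : (2 * (h : ZMod M) * ((a : ZMod M) * (L : ZMod M) + (i : ZMod M))) = ((2 * h * (a * L + i) : ℤ) : ZMod M) := by
      push_cast; ring
    rw [e, ZMod.stdAddChar_coe]
    have e2 : (2 * Real.pi * Complex.I * ((2 * h * (a * L + i) : ℤ) : ℂ) / (M : ℂ))
        = 2 * Real.pi * Complex.I * (y : ℂ) + k * (2 * Real.pi * Complex.I) := by
      have hk' : (2 * a * h : ℂ) = q * k + r.val := by exact_mod_cast congrArg (fun z : ℤ => (z : ℂ)) hk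
      have hMC : (M : ℂ) = q * L := by exact_mod_cast hL
      have hqC : (q : ℂ) ≠ 0 := by exact_mod_cast hq.ne_zero
      have hLC : (L : ℂ) ≠ 0 := by exact_mod_cast hL0
      rw [hy]
      push_cast
      rw [hMC]
      field_simp
      linear_combination hk' * L
    rw [e2, Complex.exp_add, Complex.exp_int_mul_two_pi_mul_I, mul_one]
  have hv1 : (1 : ℝ) ≤ r.val := by exact_mod_cast hrv
  have hv2 : (r.val : ℝ) + 1 ≤ q := by exact_mod_cast hrq
  have hQ0 : (0 : ℝ) < Q := lt_of_lt_of_le hq0 (by exact_mod_cast hqQ)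
  -- As `|h| ≤ 2Q` and `i/M < 1/(16Q²)`, the offset moves the phase by at most `1/(4Q)`. This is
  -- less than half the distance from `r/q` to an integer, so `y` keeps half of that distance.
  have hγ : |2 * (h : ℝ) * i / M| ≤ 1 / (2 * q) := by
    rw [abs_div, abs_of_pos hM0, div_le_div_iff₀ hM0 (by positivity), abs_mul, abs_mul]
    have hh' : |(h : ℝ)| ≤ 2 * Q := by
      have : |(h : ℝ)| ≤ H := by exact_mod_cast hh
      exact this.trans (by exact_mod_cast hHQ)
    have hi' : 16 * (Q : ℝ) ^ 2 * i ≤ M := by exact_mod_cast hi.le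
    have hqQ' : (q : ℝ) ≤ Q := by exact_mod_cast hqQ
    rw [abs_of_nonneg (by norm_num : (0 : ℝ) ≤ 2), abs_of_nonneg (Nat.cast_nonneg i : (0 : ℝ) ≤ i)]
    calc 2 * |(h : ℝ)| * i * (2 * q) ≤ 2 * (2 * Q) * i * (2 * Q) := by gcongr
      _ = 8 * ((Q : ℝ) ^ 2 * i) := by ring
      _ ≤ 1 * M := by
        have : 0 ≤ (Q : ℝ) ^ 2 * i := by positivity
        linarith
  have hγ' := abs_le.1 hγ
  have hhalf : 1 / (2 * (q : ℝ)) ≤ r.val / (2 * q) := by gcongr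
  have hhalf' : 1 / (2 * (q : ℝ)) ≤ (q - r.val) / (2 * q) := by gcongr; linarith
  have hy0 : r.val / (2 * q) ≤ y := by
    have : (r.val : ℝ) / q = r.val / (2 * q) + r.val / (2 * q) := by field_simp; ring
    rw [hy, this]; linarith [hγ'.1]
  have hy1 : (q - r.val) / (2 * q) ≤ 1 - y := by
    have : 1 - (r.val : ℝ) / q = (q - r.val) / (2 * q) + (q - r.val) / (2 * q) := by
      field_simp; ring
    rw [hy]; linarith [hγ'.2]
  have hnv : ((-r).val : ℝ) = q - r.val := by rw [hneg, Nat.cast_sub hrq.le]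
  have hd : (0 : ℝ) < q - r.val := by linarith
  have hv0 : (0 : ℝ) < r.val := by linarith
  rw [hchar, hnv]
  rcases le_total (r.val : ℝ) (q - r.val) with hle | hle
  · have hc : 4 * (r.val / (2 * q) : ℝ) ≤ _ := Complex.le_norm_exp_sub_one y (r.val / (2 * q))
      (by positivity) hy0 (le_trans (by gcongr) hy1)
    refine ⟨lt_of_lt_of_le (by positivity) hc, ?_⟩
    calc _ ≤ 2 / (4 * (r.val / (2 * q) : ℝ)) := by gcongr
      _ = q * (1 / r.val) := by field_simp; ring
      _ ≤ _ := mul_le_mul_of_nonneg_left (by linarith [one_div_pos.2 hd]) hq0.le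
  · have hc : 4 * ((q - r.val) / (2 * q) : ℝ) ≤ _ := Complex.le_norm_exp_sub_one y
      ((q - r.val) / (2 * q)) (by positivity) (le_trans (by gcongr) hy0) hy1
    refine ⟨lt_of_lt_of_le (by positivity) hc, ?_⟩
    calc _ ≤ 2 / (4 * ((q - r.val) / (2 * q) : ℝ)) := by gcongr
      _ = q * (1 / (q - r.val)) := by field_simp; ring
      _ ≤ _ := mul_le_mul_of_nonneg_left (by linarith [one_div_pos.2 hv0]) hq0.le

/-- Weyl's inequality for quadratic sums on an arc around a rational with prime denominator. -/
theorem ZMod.norm_sum_quadratic_sq_le {M q : ℕ} [NeZero M] (hq : q.Prime) (hq2 : 2 < q)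
    (hqM : q ∣ M) (a i Q N : ℕ) (hqQ : q ≤ Q) (hNQ : N ≤ Q) (hi : 16 * Q ^ 2 * i < M)
    (ha0 : 0 < a) (ha : a < q) (x : ZMod M) :
    ‖∑ n ∈ Finset.Icc (-(N : ℤ)) N, ZMod.stdAddChar ((n : ZMod M) * x
        + (n : ZMod M) ^ 2 * ((a : ZMod M) * ((M / q : ℕ) : ZMod M) + (i : ZMod M)))‖ ^ 2
      ≤ ((4 * N + 1) / q + 1) * (2 * N + 1 + 2 * q * (1 + Real.log q)) := by
  have : Fact q.Prime := ⟨hq⟩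
  have hψ : ∀ y : ZMod M, ‖ZMod.stdAddChar y‖ = 1 := fun y => by
    rw [ZMod.stdAddChar_apply, Circle.norm_coe]
  refine (AddChar.norm_sum_quadratic_sq_le _ hψ x _ N).trans ?_
  set t   : ZMod M := (a : ZMod M) * ((M / q : ℕ) : ZMod M) + (i : ZMod M)
  set u : ZMod q := ((2 * a : ℕ) : ZMod q) with hu
  have hu0 : u ≠ 0 := by
    rw [hu, Ne, ZMod.natCast_eq_zero_iff, hq.dvd_mul]
    rintro (h | h)
    · exact absurd (Nat.le_of_dvd two_pos h) (by omega)
    · exact absurd (Nat.le_of_dvd ha0 h) (by omega)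
  -- A majorant of the inner sum depending only on the residue `2ah`. The sum of both reciprocals
  -- replaces the reciprocal of `min r (q - r)`; at residue 0 both vanish (`1 / 0 = 0`) and the
  -- trivial bound takes over.
  set g : ZMod q → ℝ := fun r => (if r = 0 then (2 * N + 1 : ℝ) else 0)
    + q * (1 / (r.val : ℝ) + 1 / ((-r).val : ℝ)) with hg
  have hg0 : ∀ r, 0 ≤ g r := fun r => by
    rw [hg]; dsimp only; split_ifs <;> positivity
  have hterm : ∀ h ∈ Finset.Icc (-((2 * N : ℕ) : ℤ)) ((2 * N : ℕ) : ℤ),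
      ‖∑ m ∈ Finset.Icc (max (-(N : ℤ)) (-N - h)) (min (N : ℤ) (N - h)),
        ZMod.stdAddChar ((m : ZMod M) * (2 * (h : ZMod M) * t))‖ ≤ g (u * (h : ZMod q)) := by
    intro h hh
    have hcast : u * (h : ZMod q) = ((2 * a * h : ℤ) : ZMod q) := by
      rw [hu]; push_cast; ring
    rw [hcast]
    by_cases hr : ((2 * a * h : ℤ) : ZMod q) = 0
    · calc _ ≤ ∑ m ∈ Finset.Icc (max (-(N : ℤ)) (-N - h)) (min (N : ℤ) (N - h)), (1 : ℝ) := by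
            refine (norm_sum_le _ _).trans (Finset.sum_le_sum fun m _ => (hψ _).le)
        _ = ((Finset.Icc (max (-(N : ℤ)) (-N - h)) (min (N : ℤ) (N - h))).card : ℝ) := by simp
        _ ≤ ((Finset.Icc (-(N : ℤ)) N).card : ℝ) := by
            gcongr
            · exact le_max_left _ _
            · exact min_le_left _ _
        _ = 2 * N + 1 := by
            rw [Int.card_Icc]
            have : (N + 1 - -(N : ℤ)).toNat = 2 * N + 1 := by omega
            rw [this]; push_cast; ring
        _ ≤ _ := by
            rw [hg]; dsimp only; rw [if_pos hr]
            have : (0 : ℝ) ≤ q * (1 / (((2 * a * h : ℤ) : ZMod q).val : ℝ)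
              + 1 / ((-((2 * a * h : ℤ) : ZMod q)).val : ℝ)) := by positivity
            linarith
    · obtain ⟨hpos, hb⟩ := ZMod.le_norm_stdAddChar_sub_one hqM a i Q (2 * N) hqQ (by omega) hi h
        (by rw [Finset.mem_Icc] at hh; rw [abs_le]; exact hh) hr
      have hm := AddChar.norm_sum_Icc_mul_norm_sub_one_le (ZMod.stdAddChar (N := M)) hψ
        (2 * (h : ZMod M) * t) (max (-(N : ℤ)) (-N - h)) (min (N : ℤ) (N - h))
      rw [hg]; dsimp only; rw [if_neg hr, zero_add]
      exact ((le_div_iff₀ hpos).2 hm).trans hb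
  have h1 := ZMod.sum_mul_intCast_le q u hu0 g hg0 (2 * N)
  have h2 : ∑ r, g r ≤ 2 * N + 1 + 2 * q * (1 + Real.log q) := by
    rw [hg]
    rw [Finset.sum_add_distrib, ← Finset.mul_sum, Finset.sum_add_distrib]
    have e : ∑ r : ZMod q, 1 / ((-r).val : ℝ) = ∑ r : ZMod q, 1 / (r.val : ℝ) :=
      Equiv.sum_comp (Equiv.neg (ZMod q)) (fun r => 1 / (r.val : ℝ))
    rw [e, Finset.sum_ite_eq' Finset.univ 0, if_pos (Finset.mem_univ _)]
    have := ZMod.sum_one_div_val_le q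
    have hq0 : (0 : ℝ) < q := by exact_mod_cast hq.pos
    nlinarith
  have h3 : (0 : ℝ) ≤ (4 * N + 1) / q + 1 := by positivity
  calc _ ≤ ∑ h ∈ Finset.Icc (-((2 * N : ℕ) : ℤ)) ((2 * N : ℕ) : ℤ), g (u * (h : ZMod q)) := by
        have e : Finset.Icc (-(2 * N : ℤ)) (2 * N)
          = Finset.Icc (-((2 * N : ℕ) : ℤ)) ((2 * N : ℕ) : ℤ) := by push_cast; rfl
        rw [e]
        exact Finset.sum_le_sum hterm
    _ ≤ _ := h1
    _ = ((4 * N + 1) / q + 1) * ∑ r, g r := by push_cast; ring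
    _ ≤ _ := mul_le_mul_of_nonneg_left h2 h3

/-! ### Duality and kernel splitting on a finite abelian group. -/

/-- Bessel's inequality for a finite family of characters of a finite abelian group. -/
theorem AddChar.sum_norm_sq_le {G : Type*} [AddCommGroup G] [Fintype G] {ι : Type*}
    (T : Finset ι) (χ : ι → AddChar G ℂ) (hχ : Set.InjOn χ T) (u : G → ℂ) :
    ∑ i ∈ T, ‖∑ g, u g * χ i g‖ ^ 2 ≤ Fintype.card G * ∑ g, ‖u g‖ ^ 2 := by
  classical
  have hG : (0 : ℝ) < Fintype.card G := by exact_mod_cast Fintype.card_pos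
  set c : ℝ := (Real.sqrt (Fintype.card G))⁻¹ with hc
  have hc2 : c * c * Fintype.card G = 1 := by
    rw [hc, ← mul_inv, Real.mul_self_sqrt hG.le]; field_simp
  let v : AddChar G ℂ → EuclideanSpace ℂ G := fun ξ =>
    WithLp.toLp 2 fun g => (c : ℂ) * (starRingEnd ℂ) (ξ g)
  have hv : Orthonormal ℂ v := by
    rw [orthonormal_iff_ite]
    intro ξ η
    have : inner ℂ (v ξ) (v η) = (c : ℂ) * c * ∑ g, (ξ - η) g := by
      simp only [v, PiLp.inner_apply, RCLike.inner_apply, map_mul, Complex.conj_ofReal,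
        Complex.conj_conj, Finset.mul_sum]
      refine Finset.sum_congr rfl fun g _ => ?_
      rw [AddChar.sub_apply, AddChar.map_neg_eq_conj]
      ring
    rw [this, AddChar.sum_eq_ite]
    simp only [sub_eq_zero]
    split_ifs with h
    · exact_mod_cast hc2
    · simp
  have hb := hv.sum_inner_products_le (WithLp.toLp 2 u) (s := T.image χ)
  rw [Finset.sum_image hχ, EuclideanSpace.norm_sq_eq] at hb
  have hin : ∀ i, ‖inner ℂ (v (χ i)) (WithLp.toLp 2 u)‖ ^ 2
      = c * c * ‖∑ g, u g * χ i g‖ ^ 2 := by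
    intro i
    have : inner ℂ (v (χ i)) (WithLp.toLp 2 u) = (c : ℂ) * ∑ g, u g * χ i g := by
      simp only [v, PiLp.inner_apply, RCLike.inner_apply, map_mul, Complex.conj_ofReal,
        Complex.conj_conj, Finset.mul_sum]
      refine Finset.sum_congr rfl fun g _ => ?_
      ring
    rw [this, norm_mul, mul_pow, Complex.norm_real, Real.norm_eq_abs, sq_abs, pow_two c]
  simp_rw [hin, ← Finset.mul_sum] at hb
  calc _ = Fintype.card G * (c * c * ∑ i ∈ T, ‖∑ g, u g * χ i g‖ ^ 2) := by
        rw [← mul_assoc, mul_comm _ (c * c), hc2, one_mul]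
    _ ≤ _ := by gcongr

open scoped ZMod in
/-- Expansion of the quadratic form with kernel `K(g) Φ(τ g)`, where `K` is a sum of characters. -/
theorem AddChar.sum_kernel_mul_eq {G : Type*} [AddCommGroup G] [Fintype G] {ι : Type*} {M : ℕ}
    [NeZero M] (S : Finset ι) (χ : ι → AddChar G ℂ) (τ : G →+ ZMod M) (Φ : ZMod M → ℂ)
    (u : G → ℂ) :
    ∑ g, ∑ g', u g * (starRingEnd ℂ) (u g') * ((∑ n ∈ S, χ n (g - g')) * Φ (τ (g - g')))
      = (M : ℂ)⁻¹ * ∑ k : ZMod M, 𝓕 Φ k * ∑ n ∈ S,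
        ((‖∑ g, u g * (χ n g * ZMod.stdAddChar (k * τ g))‖ ^ 2 : ℝ) : ℂ) := by
  -- Fourier inversion turns multiplication of the kernel by Φ into a superposition of modulations.
  have hΦ : ∀ j, Φ j = (M : ℂ)⁻¹ * ∑ k : ZMod M, ZMod.stdAddChar (k * j) * 𝓕 Φ k := by
    intro j
    have h := ZMod.invDFT_apply (𝓕 Φ) j
    rw [LinearEquiv.symm_apply_apply] at h
    rw [h, smul_eq_mul]
    simp only [smul_eq_mul, mul_comm]
  have hsq : ∀ k n, ((‖∑ g, u g * (χ n g * ZMod.stdAddChar (k * τ g))‖ ^ 2 : ℝ) : ℂ)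
      = ∑ g, ∑ g', u g * (starRingEnd ℂ) (u g') * (χ n (g - g') *
          ZMod.stdAddChar (k * τ (g - g'))) := by
    intro k n
    rw [← Complex.normSq_eq_norm_sq, ← Complex.mul_conj, map_sum, Finset.sum_mul_sum]
    refine Finset.sum_congr rfl fun g _ => Finset.sum_congr rfl fun g' _ => ?_
    rw [map_mul (starRingEnd ℂ), map_mul (starRingEnd ℂ), ← AddChar.map_neg_eq_conj, ← AddChar.map_neg_eq_conj, sub_eq_add_neg,
      AddChar.map_add_eq_mul, map_add τ, mul_add, AddChar.map_add_eq_mul, map_neg τ, mul_neg]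
    ring
  simp_rw [hsq]
  simp_rw [hΦ (τ _), Finset.mul_sum, Finset.sum_mul, Finset.mul_sum]
  have e1 : ∀ f : G → G → ι → ZMod M → ℂ,
      ∑ g, ∑ g', ∑ k, ∑ n ∈ S, f g g' n k = ∑ k, ∑ n ∈ S, ∑ g, ∑ g', f g g' n k := by
    intro f
    calc _ = ∑ g, ∑ k, ∑ g', ∑ n ∈ S, f g g' n k :=
          Finset.sum_congr rfl fun g _ => Finset.sum_comm
      _ = ∑ k, ∑ g, ∑ g', ∑ n ∈ S, f g g' n k := Finset.sum_comm
      _ = ∑ k, ∑ g, ∑ n ∈ S, ∑ g', f g g' n k :=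
          Finset.sum_congr rfl fun k _ => Finset.sum_congr rfl fun g _ => Finset.sum_comm
      _ = _ := Finset.sum_congr rfl fun k _ => Finset.sum_comm
  rw [e1]
  refine Finset.sum_congr rfl fun k _ => Finset.sum_congr rfl fun n _ =>
    Finset.sum_congr rfl fun g _ => Finset.sum_congr rfl fun g' _ => ?_
  ring

open scoped ZMod in
/-- Splitting a convolution quadratic form into a pointwise small and a spectrally small part. -/
theorem AddChar.dft_zero_mul_sum_norm_sq_le {G : Type*} [AddCommGroup G] [Fintype G] {ι : Type*}
    {M : ℕ} [NeZero M] (S : Finset ι) (χ : ι → AddChar G ℂ) (τ : G →+ ZMod M) (Φ : ZMod M → ℂ)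
    (hinj : ∀ n ∈ S, ∀ n' ∈ S, ∀ k k' : ZMod M,
      (∀ g, χ n g * ZMod.stdAddChar (k * τ g) = χ n' g * ZMod.stdAddChar (k' * τ g)) →
        n = n' ∧ k = k')
    (u : G → ℂ) (P B D : ℝ) (hP : 𝓕 Φ 0 = P) (hB : ∀ g, ‖(∑ n ∈ S, χ n g) * Φ (τ g)‖ ≤ B)
    (hD : ∀ k, k ≠ 0 → ‖𝓕 Φ k‖ ≤ D) (hD0 : 0 ≤ D) :
    P * ∑ n ∈ S, ‖∑ g, u g * χ n g‖ ^ 2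
      ≤ M * B * (∑ g, ‖u g‖) ^ 2 + D * (Fintype.card G * ∑ g, ‖u g‖ ^ 2) := by
  classical
  have hM : (M : ℂ) ≠ 0 := by exact_mod_cast NeZero.ne M
  set s : ZMod M → ℝ := fun k => ∑ n ∈ S, ‖∑ g, u g * (χ n g * ZMod.stdAddChar (k * τ g))‖ ^ 2
    with hs
  have hs0 : s 0 = ∑ n ∈ S, ‖∑ g, u g * χ n g‖ ^ 2 := by simp [hs]
  have hsnn : ∀ k, 0 ≤ s k := fun k => by positivity
  have key := AddChar.sum_kernel_mul_eq S χ τ Φ u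
  simp_rw [← Complex.ofReal_sum] at key
  set LHS := ∑ g, ∑ g', u g * (starRingEnd ℂ) (u g') *
    ((∑ n ∈ S, χ n (g - g')) * Φ (τ (g - g'))) with hLHS
  have hL : ‖LHS‖ ≤ B * (∑ g, ‖u g‖) ^ 2 := by
    calc ‖LHS‖ ≤ ∑ g, ∑ g', ‖u g‖ * ‖u g'‖ * B := by
          refine norm_sum_le_of_le _ fun g _ => norm_sum_le_of_le _ fun g' _ => ?_
          rw [norm_mul, norm_mul, RCLike.norm_conj]
          exact mul_le_mul_of_nonneg_left (hB _) (by positivity)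
      _ = B * (∑ g, ‖u g‖) ^ 2 := by
          simp_rw [← Finset.sum_mul, ← Finset.mul_sum, ← Finset.sum_mul]
          ring
  -- One application of Bessel to all pairs `(k, n)`: `hinj` makes the modulated characters
  -- distinct, so no factor is lost in the sum over `k`.
  have hbes : ∑ k, s k ≤ Fintype.card G * ∑ g, ‖u g‖ ^ 2 := by
    let ξ : ZMod M × ι → AddChar G ℂ := fun p =>
      χ p.2 * (AddChar.mulShift ZMod.stdAddChar p.1).compAddMonoidHom τ
    have hξ : ∀ p g, ξ p g = χ p.2 g * ZMod.stdAddChar (p.1 * τ g) := fun p g => by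
      simp [ξ]
    have := AddChar.sum_norm_sq_le (Finset.univ ×ˢ S) ξ (by
      rintro ⟨k, n⟩ hn ⟨k', n'⟩ hn' h
      have hh := hinj n (by simpa using hn) n' (by simpa using hn') k k' (fun g => by
        have := DFunLike.congr_fun h g
        rwa [hξ, hξ] at this)
      rw [hh.1, hh.2]) u
    rw [Finset.sum_product] at this
    simp_rw [hξ] at this
    exact this
  -- The zero frequency, which carries the wanted form, is isolated; `LHS` is small pointwise and
  -- the remaining frequencies are small spectrally.
  have h1 : (P * s 0 : ℂ) = M * LHS - ∑ k ∈ Finset.univ.erase (0 : ZMod M), 𝓕 Φ k * (s k : ℂ) := by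
    rw [key, ← mul_assoc, mul_inv_cancel₀ hM, one_mul,
      ← Finset.add_sum_erase Finset.univ _ (Finset.mem_univ (0 : ZMod M)), hP]
    simp [hs]
  have h2 : P * s 0 ≤ ‖(P * s 0 : ℂ)‖ := by
    rw [← Complex.ofReal_mul, Complex.norm_real]; exact le_abs_self _
  rw [← hs0]
  refine h2.trans ?_
  rw [h1]
  refine (norm_sub_le _ _).trans (add_le_add ?_ ?_)
  · rw [norm_mul, Complex.norm_natCast, mul_assoc]
    gcongr
  · calc _ ≤ ∑ k ∈ Finset.univ.erase (0 : ZMod M), D * s k := by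
          refine norm_sum_le_of_le _ fun k hk => ?_
          rw [norm_mul, Complex.norm_real, Real.norm_of_nonneg (hsnn k)]
          exact mul_le_mul_of_nonneg_right (hD k (Finset.ne_of_mem_erase hk)) (hsnn k)
      _ = D * ∑ k ∈ Finset.univ.erase (0 : ZMod M), s k := by rw [Finset.mul_sum]
      _ ≤ D * ∑ k, s k := by
          gcongr
          exact Finset.erase_subset _ _
      _ ≤ _ := by gcongr

/-- The dual form of a large value estimate. -/
theorem AddChar.sq_mul_card_sq_le {G : Type*} [AddCommGroup G] {ι : Type*}
    (S : Finset ι) (χ : ι → AddChar G ℂ) (a : ι → ℂ) (ha : ∑ n ∈ S, ‖a n‖ ^ 2 ≤ 1)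
    (E : Finset G) (lam : ℝ) (hlam : 0 ≤ lam) (hE : ∀ g ∈ E, lam ≤ ‖∑ n ∈ S, a n * χ n g‖) :
    ∃ u : G → ℂ, (∀ g ∈ E, ‖u g‖ ≤ 1) ∧
      (lam * E.card) ^ 2 ≤ ∑ n ∈ S, ‖∑ g ∈ E, u g * χ n g‖ ^ 2 := by
  have hu : ∀ z : ℂ, ∃ w : ℂ, ‖w‖ ≤ 1 ∧ w * z = ‖z‖ := by
    intro z
    rcases eq_or_ne z 0 with rfl | hz
    · exact ⟨0, by simp, by simp⟩
    · have hz' : (‖z‖ : ℂ) ≠ 0 := by simpa using hz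
      refine ⟨‖z‖ / z, ?_, by field_simp⟩
      simp [hz]
  choose w hw1 hw2 using hu
  set F : G → ℂ := fun g => ∑ n ∈ S, a n * χ n g with hF
  refine ⟨fun g => w (F g), fun g _ => hw1 _, ?_⟩
  have h1 : lam * E.card ≤ ∑ g ∈ E, ‖F g‖ := by
    rw [mul_comm, ← nsmul_eq_mul]
    exact Finset.card_nsmul_le_sum _ _ _ hE
  have h2 : ((∑ g ∈ E, ‖F g‖ : ℝ) : ℂ) = ∑ n ∈ S, a n * ∑ g ∈ E, w (F g) * χ n g := by
    push_cast
    simp_rw [← hw2, Finset.mul_sum]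
    rw [Finset.sum_comm]
    refine Finset.sum_congr rfl fun g _ => ?_
    conv_lhs => rw [hF]
    dsimp only
    rw [Finset.mul_sum]
    exact Finset.sum_congr rfl fun n _ => by ring
  have h3 : ∑ g ∈ E, ‖F g‖ ≤ ∑ n ∈ S, ‖a n‖ * ‖∑ g ∈ E, w (F g) * χ n g‖ := by
    have h0 : (0 : ℝ) ≤ ∑ g ∈ E, ‖F g‖ := by positivity
    calc ∑ g ∈ E, ‖F g‖ = ‖((∑ g ∈ E, ‖F g‖ : ℝ) : ℂ)‖ := by
          rw [Complex.norm_real, Real.norm_of_nonneg h0]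
      _ ≤ _ := by
          rw [h2]
          exact norm_sum_le_of_le _ fun n _ => (norm_mul _ _).le
  calc (lam * E.card) ^ 2 ≤ (∑ n ∈ S, ‖a n‖ * ‖∑ g ∈ E, w (F g) * χ n g‖) ^ 2 := by
        gcongr
        exact h1.trans h3
    _ ≤ (∑ n ∈ S, ‖a n‖ ^ 2) * ∑ n ∈ S, ‖∑ g ∈ E, w (F g) * χ n g‖ ^ 2 :=
        Finset.sum_mul_sq_le_sq_mul_sq _ _ _
    _ ≤ 1 * _ := by gcongr
    _ = _ := one_mul _

/-! ### The arcs and the Fourier transform of their indicator. -/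

/-- Parameters `(q, a, i)` of the points `a / q + i / M` of the arcs of `ℤ/M` with denominators in
`S` and length `J`. -/
def arcIndex (S : Finset ℕ) (J : ℕ) : Finset (Σ _ : ℕ, ℕ × ℕ) :=
  S.sigma fun q => Finset.Ico 1 q ×ˢ Finset.range J

/-- The point of `ℤ/M ⊆ ℝ/ℤ` representing `a / q + i / M`. -/
def arcPoint (M : ℕ) (s : Σ _ : ℕ, ℕ × ℕ) : ZMod M :=
  (s.2.1 : ZMod M) * ((M / s.1 : ℕ) : ZMod M) + (s.2.2 : ZMod M)

/-- The arcs in `ℤ/M` to the right of the reduced fractions with denominators in `S`. -/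
def arcs (M : ℕ) (S : Finset ℕ) (J : ℕ) : Finset (ZMod M) :=
  (arcIndex S J).image (arcPoint M)

/-- The indicator function of `arcs`. -/
def arcIndicator (M : ℕ) (S : Finset ℕ) (J : ℕ) (j : ZMod M) : ℂ :=
  if j ∈ arcs M S J then 1 else 0

/-- Distinct reduced fractions with denominators at most `Q` are at least `1/Q²` apart modulo 1,
whereas each arc has length `J/M = 1/(16Q²)`. -/
theorem arcPoint_injOn {M J Q : ℕ} {S : Finset ℕ} (hS : ∀ q ∈ S, q.Prime) (hQ : ∀ q ∈ S, q ≤ Q)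
    (hM : ∀ q ∈ S, q ∣ M) (hJ : 16 * Q ^ 2 * J = M) (hJ0 : 0 < J) :
    Set.InjOn (arcPoint M) (arcIndex S J) := by
  rintro ⟨q, a, i⟩ h ⟨q', a', i'⟩ h' heq
  simp only [arcIndex, Finset.coe_sigma, Set.mem_sigma_iff, Finset.mem_coe, Finset.mem_product,
    Finset.mem_Ico, Finset.mem_range] at h h'
  obtain ⟨hq, ⟨ha1, haq⟩, hi⟩ := h
  obtain ⟨hq', ⟨ha1', haq'⟩, hi'⟩ := h'
  obtain ⟨L, hL⟩ := hM q hq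
  obtain ⟨L', hL'⟩ := hM q' hq'
  have pq := hS q hq
  have pq' := hS q' hq'
  have e : M / q = L := by rw [hL]; exact Nat.mul_div_cancel_left _ pq.pos
  have e' : M / q' = L' := by rw [hL']; exact Nat.mul_div_cancel_left _ pq'.pos
  have hQ0 : 0 < Q := pq.pos.trans_le (hQ q hq)
  have hM0 : 0 < M := by rw [← hJ]; positivity
  have hdvd : (M : ℤ) ∣ (a * L + i - (a' * L' + i') : ℤ) := by
    rw [← ZMod.intCast_zmod_eq_zero_iff_dvd]
    simp only [arcPoint, e, e'] at heq
    push_cast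
    rw [heq, sub_self]
  obtain ⟨k, hk⟩ := hdvd
  have hmul : ((a * q' - a' * q - k * (q * q') : ℤ)) * M = (i' - i) * (q * q') := by
    have h1 : (M : ℤ) = q * L := by exact_mod_cast hL
    have h2 : (M : ℤ) = q' * L' := by exact_mod_cast hL'
    have e1 : (a * q' : ℤ) * M = a * q' * (q * L) := by rw [← h1]
    have e2 : (a' * q : ℤ) * M = a' * q * (q' * L') := by rw [← h2]
    linear_combination e1 - e2 + (q * q' : ℤ) * hk
  -- A nonzero integer here would make the left side of `hmul` at least `M` in absolute value, while
  -- the right side is at most `JQ² = M/16`.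
  have hz : (a * q' - a' * q - k * (q * q') : ℤ) = 0 := by
    by_contra hne
    have h1 : (M : ℤ) ≤ |(a * q' - a' * q - k * (q * q') : ℤ) * M| := by
      rw [abs_mul, abs_of_pos (by exact_mod_cast hM0 : (0 : ℤ) < M)]
      exact le_mul_of_one_le_left (by positivity) (Int.one_le_abs hne)
    have h2 : |((i' : ℤ) - i) * (q * q')| ≤ J * (Q * Q) := by
      rw [abs_mul, abs_of_nonneg (by positivity : (0 : ℤ) ≤ q * q')]
      have : |(i' : ℤ) - i| ≤ J := by rw [abs_le]; omega
      have hqQ : (q : ℤ) ≤ Q := by exact_mod_cast hQ q hq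
      have hqQ' : (q' : ℤ) ≤ Q := by exact_mod_cast hQ q' hq'
      gcongr
    rw [hmul] at h1
    have h3 : (M : ℤ) = 16 * (J * (Q * Q)) := by rw [← hJ]; push_cast; ring
    have h4 : (0 : ℤ) < J * (Q * Q) := by positivity
    linarith
  have hii : (i' : ℤ) = i := by
    rw [hz, zero_mul] at hmul
    have : (q * q' : ℤ) ≠ 0 := by
      have := pq.ne_zero; have := pq'.ne_zero; positivity
    rcases mul_eq_zero.1 hmul.symm with h | h
    · linarith
    · exact absurd h this
  have hqq : q = q' := by
    have hd : (q : ℤ) ∣ a * q' := ⟨a' + k * q', by linear_combination hz⟩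
    have hd' : q ∣ a * q' := by exact_mod_cast hd
    rcases pq.dvd_mul.1 hd' with h | h
    · exact absurd (Nat.le_of_dvd ha1 h) (by omega)
    · exact (Nat.prime_dvd_prime_iff_eq pq pq').1 h
  subst hqq
  have haa : a = a' := by
    have hd : (q : ℤ) ∣ (a - a' : ℤ) := by
      refine ⟨k, ?_⟩
      have hq0 : (q : ℤ) ≠ 0 := by exact_mod_cast pq.ne_zero
      exact mul_right_cancel₀ hq0 (by linear_combination hz)
    have := Int.eq_zero_of_abs_lt_dvd hd (by rw [abs_lt]; omega)
    omega
  have : i = i' := by exact_mod_cast hii.symm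
  subst haa; subst this; rfl

theorem ZMod.norm_stdAddChar {M : ℕ} [NeZero M] (y : ZMod M) : ‖ZMod.stdAddChar y‖ = 1 := by
  rw [ZMod.stdAddChar_apply, Circle.norm_coe]

theorem AddChar.norm_sum_range_mul_norm_sub_one_le {R : Type*} [CommRing R] (ψ : AddChar R ℂ)
    (hψ : ∀ x, ‖ψ x‖ = 1) (z : R) (J : ℕ) :
    ‖∑ m ∈ Finset.range J, ψ ((m : R) * z)‖ * ‖ψ z - 1‖ ≤ 2 := by
  simp_rw [← nsmul_eq_mul, AddChar.map_nsmul_eq_pow]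
  rw [← norm_mul, geom_sum_mul]
  calc _ ≤ ‖ψ z ^ J‖ + ‖(1 : ℂ)‖ := norm_sub_le _ _
    _ = 2 := by rw [norm_pow, hψ]; norm_num

open scoped ZMod in
-- Injectivity of the parametrisation lets the transform be summed over `(q, a, i)`, where it
-- factors into a sum over fractions and a geometric sum along one arc.
theorem dft_arcIndicator {M J Q : ℕ} [NeZero M] {S : Finset ℕ} (hS : ∀ q ∈ S, q.Prime)
    (hQ : ∀ q ∈ S, q ≤ Q) (hM : ∀ q ∈ S, q ∣ M) (hJ : 16 * Q ^ 2 * J = M) (hJ0 : 0 < J)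
    (k : ZMod M) :
    𝓕 (arcIndicator M S J) k = (∑ q ∈ S, ∑ a ∈ Finset.Ico 1 q,
        ZMod.stdAddChar ((a : ZMod M) * (((M / q : ℕ) : ZMod M) * (-k)))) *
      ∑ i ∈ Finset.range J, ZMod.stdAddChar ((i : ZMod M) * (-k)) := by
  rw [ZMod.dft_apply]
  simp only [arcIndicator, smul_eq_mul, mul_ite, mul_one, mul_zero]
  rw [← Finset.sum_filter, Finset.filter_mem_eq_inter, Finset.univ_inter, arcs,
    Finset.sum_image (arcPoint_injOn hS hQ hM hJ hJ0), arcIndex, Finset.sum_sigma, Finset.sum_mul]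
  refine Finset.sum_congr rfl fun q _ => ?_
  rw [Finset.sum_mul_sum, Finset.sum_product]
  refine Finset.sum_congr rfl fun a _ => Finset.sum_congr rfl fun i _ => ?_
  rw [← AddChar.map_add_eq_mul]
  congr 1
  simp only [arcPoint]
  ring

open scoped ZMod in
theorem dft_arcIndicator_zero {M J Q : ℕ} [NeZero M] {S : Finset ℕ} (hS : ∀ q ∈ S, q.Prime)
    (hQ : ∀ q ∈ S, q ≤ Q) (hM : ∀ q ∈ S, q ∣ M) (hJ : 16 * Q ^ 2 * J = M) (hJ0 : 0 < J) :
    𝓕 (arcIndicator M S J) 0 = ((J * ∑ q ∈ S, ((q - 1 : ℕ) : ℝ) : ℝ) : ℂ) := by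
  rw [dft_arcIndicator hS hQ hM hJ hJ0]
  simp [mul_comm]

/-- Five distinct primes of size at least `Q^{4/5}` dividing `κ` would force `κ ≥ Q⁴`. -/
theorem Nat.card_filter_dvd_le_four {Q : ℕ} {S : Finset ℕ} (hS : ∀ q ∈ S, q.Prime)
    (hQ0 : 0 < Q) (hR : ∀ q ∈ S, Q ^ 4 ≤ q ^ 5) {κ : ℕ} (hκ0 : κ ≠ 0) (hκ : κ < Q ^ 4) :
    (S.filter fun q => q ∣ κ).card ≤ 4 := by
  by_contra! hcard
  set T := S.filter fun q => q ∣ κ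
  have h1 : ∏ q ∈ T, q ≤ κ := by
    refine Nat.le_of_dvd (Nat.pos_of_ne_zero hκ0) (Finset.prod_primes_dvd κ ?_ ?_)
    · exact fun q hq => (hS q (Finset.mem_filter.1 hq).1).prime
    · exact fun q hq => (Finset.mem_filter.1 hq).2
  have h2 : (Q ^ 4) ^ T.card ≤ (∏ q ∈ T, q) ^ 5 := by
    rw [← Finset.prod_pow]
    exact Finset.pow_card_le_prod _ _ _ fun q hq => hR q (Finset.mem_filter.1 hq).1
  have h3 : (Q ^ 4) ^ 5 ≤ (Q ^ 4) ^ T.card := Nat.pow_le_pow_right (by positivity) hcard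
  have h4 : (∏ q ∈ T, q) ^ 5 ≤ κ ^ 5 := Nat.pow_le_pow_left h1 5
  have h5 : κ ^ 5 < (Q ^ 4) ^ 5 := Nat.pow_lt_pow_left hκ (by norm_num)
  omega

/-- This is the Ramanujan sum of a prime modulus: `q - 1` if `q ∣ κ`, and `-1` otherwise. -/
theorem ZMod.norm_sum_stdAddChar_mul_le {M q : ℕ} [NeZero M] (hq : q.Prime) (hqM : q ∣ M) (κ : ℤ) :
    ‖∑ a ∈ Finset.Ico 1 q, ZMod.stdAddChar ((a : ZMod M) * (((M / q : ℕ) : ZMod M)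
      * (-(κ : ZMod M))))‖ ≤ 1 + if (q : ℤ) ∣ κ then (q : ℝ) else 0 := by
  split_ifs with hd
  · refine (norm_sum_le_of_le _ fun a _ => (ZMod.norm_stdAddChar _).le).trans ?_
    simp only [Finset.sum_const, Nat.card_Ico, nsmul_eq_mul, mul_one]
    have : ((q - 1 : ℕ) : ℝ) ≤ q := by exact_mod_cast Nat.sub_le _ _
    linarith
  · obtain ⟨L, hL⟩ := hqM
    have hL' : M / q = L := by rw [hL]; exact Nat.mul_div_cancel_left _ hq.pos
    rw [hL']
    have hM0 : M ≠ 0 := NeZero.ne M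
    have hL0 : (L : ℤ) ≠ 0 := by
      rintro h
      have : L = 0 := by exact_mod_cast h
      rw [this, mul_zero] at hL; exact hM0 hL
    set z : ZMod M := (L : ZMod M) * (-(κ : ZMod M)) with hz
    have hone : ZMod.stdAddChar z ≠ 1 := by
      intro h
      rw [← AddChar.map_zero_eq_one (ZMod.stdAddChar (N := M))] at h
      have h0 := ZMod.injective_stdAddChar h
      have : ((-(L * κ) : ℤ) : ZMod M) = 0 := by rw [← h0, hz]; push_cast; ring
      rw [ZMod.intCast_zmod_eq_zero_iff_dvd, hL, dvd_neg] at this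
      push_cast at this
      rw [mul_comm (q : ℤ)] at this
      exact hd ((mul_dvd_mul_iff_left hL0).1 this)
    have hpow : ZMod.stdAddChar z ^ q = 1 := by
      rw [← AddChar.map_nsmul_eq_pow, hz, nsmul_eq_mul, ← mul_assoc]
      have : (q : ZMod M) * (L : ZMod M) = 0 := by
        rw [← Nat.cast_mul, ← hL]; simp
      rw [this, zero_mul, AddChar.map_zero_eq_one]
    have hsum : ∑ a ∈ Finset.range q, ZMod.stdAddChar ((a : ZMod M) * z) = 0 := by
      simp_rw [← nsmul_eq_mul, AddChar.map_nsmul_eq_pow]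
      have := geom_sum_mul (ZMod.stdAddChar z) q
      rw [hpow, sub_self] at this
      exact (mul_eq_zero.1 this).resolve_right (sub_ne_zero.2 hone)
    rw [Finset.range_eq_Ico, Finset.sum_eq_sum_Ico_succ_bot hq.pos] at hsum
    have : ∑ a ∈ Finset.Ico 1 q, ZMod.stdAddChar ((a : ZMod M) * z) = -1 := by
      have h0 : ZMod.stdAddChar (((0 : ℕ) : ZMod M) * z) = 1 := by simp
      rw [h0] at hsum
      linear_combination hsum
    rw [this]
    simp

/-- A geometric sum; since `|κ| ≤ M/2`, the distance of `κ/M` to the nearest integer is `|κ|/M`. -/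
theorem ZMod.norm_sum_range_stdAddChar_le {M : ℕ} [NeZero M] (J : ℕ) (κ : ℤ) (hκ0 : κ ≠ 0)
    (hκ : 2 * |κ| ≤ M) :
    ‖∑ i ∈ Finset.range J, ZMod.stdAddChar ((i : ZMod M) * (-(κ : ZMod M)))‖ ≤ M / (2 * |(κ : ℝ)|) := by
  have hM0 : (0 : ℝ) < M := by exact_mod_cast NeZero.pos M
  have hk : (0 : ℝ) < |(κ : ℝ)| := by exact_mod_cast abs_pos.2 hκ0
  have hk2 : 2 * |(κ : ℝ)| ≤ M := by exact_mod_cast hκ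
  have h1 := AddChar.norm_sum_range_mul_norm_sub_one_le (ZMod.stdAddChar (N := M))
    ZMod.norm_stdAddChar (-(κ : ZMod M)) J
  have hy : |(κ : ℝ)| / M ≤ 1 - |(κ : ℝ)| / M := by
    rw [← sub_nonneg]
    have : 1 - |(κ : ℝ)| / M - |(κ : ℝ)| / M = (M - 2 * |(κ : ℝ)|) / M := by field_simp; ring
    rw [this]
    exact div_nonneg (by linarith) hM0.le
  have h2 := Complex.le_norm_exp_sub_one (|(κ : ℝ)| / M) (|(κ : ℝ)| / M) (by positivity) le_rfl hy
  have h3 : ‖ZMod.stdAddChar (-(κ : ZMod M)) - 1‖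
      = ‖Complex.exp (2 * Real.pi * Complex.I * ((|(κ : ℝ)| / M : ℝ) : ℂ)) - 1‖ := by
    have e : ∀ m : ℤ, Complex.exp (2 * Real.pi * Complex.I * ((m / M : ℝ) : ℂ))
        = ZMod.stdAddChar (m : ZMod M) := by
      intro m
      rw [ZMod.stdAddChar_coe]; push_cast; congr 1; ring
    have hinv : ∀ x : ZMod M, ‖ZMod.stdAddChar (-x) - 1‖ = ‖ZMod.stdAddChar x - 1‖ := by
      intro x
      rw [AddChar.map_neg_eq_conj, ← RCLike.norm_conj (ZMod.stdAddChar x - 1)]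
      simp
    have : ((|(κ : ℝ)| / M : ℝ)) = ((|κ| : ℤ) : ℝ) / M := by push_cast; rfl
    rw [this, e]
    rcases abs_choice κ with h | h
    · rw [h, hinv]
    · rw [h]; push_cast; rfl
  rw [h3] at h1
  set A := ‖∑ i ∈ Finset.range J, ZMod.stdAddChar ((i : ZMod M) * (-(κ : ZMod M)))‖
  have hA : 0 ≤ A := norm_nonneg _
  have h4 : A * (4 * (|(κ : ℝ)| / M)) ≤ 2 := le_trans (by gcongr) h1
  rw [le_div_iff₀ (by positivity)]
  have : A * (4 * (|(κ : ℝ)| / M)) = 2 * (A * (2 * |(κ : ℝ)|)) / M := by ring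
  rw [this, div_le_iff₀ hM0] at h4
  linarith

open scoped ZMod in
/-- Off the zero frequency, the Fourier coefficients of the indicator of the arcs are small. -/
theorem norm_dft_arcIndicator_le {M J Q : ℕ} [NeZero M] {S : Finset ℕ} (hS : ∀ q ∈ S, q.Prime)
    (hQ : ∀ q ∈ S, q ≤ Q) (hM : ∀ q ∈ S, q ∣ M) (hJ : 16 * Q ^ 2 * J = M) (hJ0 : 0 < J)
    (hR : ∀ q ∈ S, Q ^ 4 ≤ q ^ 5) (hQ0 : 0 < Q) (k : ZMod M) (hk : k ≠ 0) :
    ‖𝓕 (arcIndicator M S J) k‖ ≤ 8 * Q * J := by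
  set κ : ℤ := k.valMinAbs with hκ
  have hkκ : k = (κ : ZMod M) := by rw [hκ, ZMod.coe_valMinAbs]
  have hκ0 : κ ≠ 0 := by rw [hκ, Ne, ZMod.valMinAbs_eq_zero]; exact hk
  have hκM : 2 * |κ| ≤ M := by
    have := ZMod.natAbs_valMinAbs_le k
    rw [← hκ] at this
    rw [Int.abs_eq_natAbs]
    omega
  have hQ0' : (0 : ℝ) < Q := by exact_mod_cast hQ0
  have hJ' : (0 : ℝ) < J := by exact_mod_cast hJ0
  have hcard : (S.card : ℝ) ≤ Q := by
    have : S ⊆ Finset.Icc 1 Q := fun q hq => by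
      rw [Finset.mem_Icc]; exact ⟨(hS q hq).pos, hQ q hq⟩
    have := Finset.card_le_card this
    rw [Nat.card_Icc] at this
    exact_mod_cast this
  rw [dft_arcIndicator hS hQ hM hJ hJ0, norm_mul, hkκ]
  -- Low frequencies: at most four Ramanujan sums are large, so the sum over fractions is at most
  -- `5Q` and the arc sum is bounded by `J`. High frequencies: the trivial `Q²` is beaten by the
  -- decay of the arc sum, as `Q² · M/(2Q⁴) = 8J`.
  rcases lt_or_ge κ.natAbs (Q ^ 4) with hlt | hge
  · have h1 : ‖∑ q ∈ S, ∑ a ∈ Finset.Ico 1 q, ZMod.stdAddChar ((a : ZMod M) *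
        (((M / q : ℕ) : ZMod M) * (-(κ : ZMod M))))‖ ≤ 5 * Q := by
      calc _ ≤ ∑ q ∈ S, (1 + if q ∣ κ.natAbs then (Q : ℝ) else 0) := by
            refine norm_sum_le_of_le _ fun q hq => ?_
            refine (ZMod.norm_sum_stdAddChar_mul_le (hS q hq) (hM q hq) κ).trans ?_
            simp only [Int.natCast_dvd]
            gcongr
            split_ifs
            · exact_mod_cast hQ q hq
            · exact le_rfl
        _ = S.card + ((S.filter fun q => q ∣ κ.natAbs).card : ℝ) * Q := by
            rw [Finset.sum_add_distrib, ← Finset.sum_filter]; simp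
        _ ≤ Q + 4 * Q := by
            have := Nat.card_filter_dvd_le_four hS hQ0 hR (Int.natAbs_ne_zero.2 hκ0) hlt
            gcongr
            exact_mod_cast this
        _ = 5 * Q := by ring
    have h2 : ‖∑ i ∈ Finset.range J, ZMod.stdAddChar ((i : ZMod M) * (-(κ : ZMod M)))‖ ≤ J := by
      refine (norm_sum_le_of_le _ fun a _ => (ZMod.norm_stdAddChar _).le).trans ?_
      simp
    calc _ ≤ 5 * (Q : ℝ) * J := by gcongr
      _ ≤ _ := by gcongr; norm_num
  · have h1 : ‖∑ q ∈ S, ∑ a ∈ Finset.Ico 1 q, ZMod.stdAddChar ((a : ZMod M) *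
        (((M / q : ℕ) : ZMod M) * (-(κ : ZMod M))))‖ ≤ Q * Q := by
      calc _ ≤ ∑ q ∈ S, (Q : ℝ) := by
            refine norm_sum_le_of_le _ fun q hq => ?_
            refine (norm_sum_le_of_le _ fun a _ => (ZMod.norm_stdAddChar _).le).trans ?_
            simp only [Finset.sum_const, Nat.card_Ico, nsmul_eq_mul, mul_one]
            exact_mod_cast (Nat.sub_le q 1).trans (hQ q hq)
        _ = S.card * Q := by simp
        _ ≤ _ := by gcongr
    have h2 := ZMod.norm_sum_range_stdAddChar_le (M := M) J κ hκ0 hκM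
    have hκQ : (Q : ℝ) ^ 4 ≤ |(κ : ℝ)| := by
      have : ((κ.natAbs : ℕ) : ℝ) = |(κ : ℝ)| := by rw [Nat.cast_natAbs]; push_cast; rfl
      rw [← this]; exact_mod_cast hge
    have hMR : (M : ℝ) = 16 * Q ^ 2 * J := by rw [← hJ]; push_cast; ring
    calc _ ≤ ((Q : ℝ) * Q) * (M / (2 * |(κ : ℝ)|)) := by gcongr
      _ ≤ ((Q : ℝ) * Q) * (M / (2 * Q ^ 4)) := by
        gcongr
      _ = 8 * 1 * J := by rw [hMR]; field_simp; ring
      _ ≤ _ := by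
        gcongr
        exact_mod_cast hQ0

/-! ### Paraboloid characters and large values on the grid. -/

/-- The character `(x, t) ↦ e((n·x + |n|²t) / M)` of `(ℤ/M)ᵈ × ℤ/M`. -/
noncomputable def paraboloidChar (M : ℕ) [NeZero M] {d : ℕ} (n : Fin d → ℤ) :
    AddChar ((Fin d → ZMod M) × ZMod M) ℂ where
  toFun g := ZMod.stdAddChar (∑ j, (n j : ZMod M) * g.1 j + (∑ j, (n j : ZMod M) ^ 2) * g.2)
  map_zero_eq_one' := by simp
  map_add_eq_mul' g g' := by
    rw [← AddChar.map_add_eq_mul]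
    congr 1
    simp only [Prod.fst_add, Prod.snd_add, Pi.add_apply, mul_add, Finset.sum_add_distrib]
    ring

theorem paraboloidChar_apply (M : ℕ) [NeZero M] {d : ℕ} (n : Fin d → ℤ)
    (g : (Fin d → ZMod M) × ZMod M) : paraboloidChar M n g
      = ZMod.stdAddChar (∑ j, (n j : ZMod M) * g.1 j + (∑ j, (n j : ZMod M) ^ 2) * g.2) := rfl

theorem mem_freqBox {d N : ℕ} {n : Fin d → ℤ} :
    n ∈ freqBox d N ↔ ∀ j, -(N : ℤ) ≤ n j ∧ n j ≤ N := by
  simp [freqBox, Fintype.mem_piFinset]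

/-- Testing on coordinate vectors recovers `n` modulo `M`, hence `n` because `2N < M`; testing at
`(0, 1)` then recovers `k`. This supplies the independence needed for Bessel. -/
theorem paraboloidChar_injective {M d N : ℕ} [NeZero M] (hM : 2 * N < M) (n : Fin d → ℤ)
    (hn : n ∈ freqBox d N) (n' : Fin d → ℤ) (hn' : n' ∈ freqBox d N) (k k' : ZMod M)
    (h : ∀ g : (Fin d → ZMod M) × ZMod M, paraboloidChar M n g * ZMod.stdAddChar (k * g.2)
      = paraboloidChar M n' g * ZMod.stdAddChar (k' * g.2)) : n = n' ∧ k = k' := by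
  have hnn : n = n' := by
    funext j
    have := h (Pi.single j 1, 0)
    simp only [paraboloidChar_apply, mul_zero, add_zero, AddChar.map_zero_eq_one, mul_one] at this
    have := ZMod.injective_stdAddChar this
    simp only [Pi.single_apply, mul_ite, mul_one, mul_zero, Finset.sum_ite_eq',
      Finset.mem_univ, if_true] at this
    have h0 : ((n j - n' j : ℤ) : ZMod M) = 0 := by push_cast; rw [this, sub_self]
    rw [ZMod.intCast_zmod_eq_zero_iff_dvd] at h0
    have b := mem_freqBox.1 hn j
    have b' := mem_freqBox.1 hn' j
    have := Int.eq_zero_of_abs_lt_dvd h0 (by rw [abs_lt]; omega)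
    omega
  refine ⟨hnn, ?_⟩
  subst hnn
  have := h (0, 1)
  have hne : paraboloidChar M n (0, 1) ≠ 0 := by
    rw [paraboloidChar_apply, ← norm_ne_zero_iff, ZMod.norm_stdAddChar]; norm_num
  have := mul_left_cancel₀ hne this
  simpa using ZMod.injective_stdAddChar this

theorem paraboloidChar_injOn {M d N : ℕ} [NeZero M] (hM : 2 * N < M) :
    Set.InjOn (paraboloidChar M (d := d)) (freqBox d N) := by
  intro n hn n' hn' h
  exact (paraboloidChar_injective hM n hn n' hn' 0 0 fun g => by rw [h]).1

theorem AddChar.map_sum_eq_prod {A R ι : Type*} [AddCommMonoid A] [CommMonoid R] (ψ : AddChar A R)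
    (s : Finset ι) (f : ι → A) : ψ (∑ i ∈ s, f i) = ∏ i ∈ s, ψ (f i) := by
  classical
  induction s using Finset.induction_on with
  | empty => simp
  | insert i s hi ih =>
    rw [Finset.sum_insert hi, Finset.prod_insert hi, AddChar.map_add_eq_mul, ih]

theorem sum_paraboloidChar (M : ℕ) [NeZero M] (d N : ℕ) (g : (Fin d → ZMod M) × ZMod M) :
    ∑ n ∈ freqBox d N, paraboloidChar M n g = ∏ j, ∑ m ∈ Finset.Icc (-(N : ℤ)) N,
      ZMod.stdAddChar ((m : ZMod M) * g.1 j + (m : ZMod M) ^ 2 * g.2) := by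
  rw [Finset.prod_univ_sum, freqBox]
  refine Finset.sum_congr rfl fun n _ => ?_
  rw [paraboloidChar_apply, Finset.sum_mul, ← Finset.sum_add_distrib, AddChar.map_sum_eq_prod]

open scoped ZMod in
/-- The large value estimate on the finite grid, for arcs with denominators in `S`. -/
theorem sq_mul_card_mul_le {M J Q N d : ℕ} [NeZero M] {S : Finset ℕ} (hS : ∀ q ∈ S, q.Prime)
    (hQ : ∀ q ∈ S, q ≤ Q) (hM : ∀ q ∈ S, q ∣ M) (hJ : 16 * Q ^ 2 * J = M) (hJ0 : 0 < J)
    (hR : ∀ q ∈ S, Q ^ 4 ≤ q ^ 5) (hS2 : ∀ q ∈ S, 2 < q) (hN : 1 ≤ N) (hNQ : N ≤ Q)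
    (w : ℝ) (hw0 : 0 ≤ w)
    (hw : ∀ q ∈ S, ((4 * N + 1) / q + 1) * (2 * N + 1 + 2 * q * (1 + Real.log q)) ≤ w ^ 2)
    (a : (Fin d → ℤ) → ℂ) (ha : ∑ n ∈ freqBox d N, ‖a n‖ ^ 2 ≤ 1)
    (E : Finset ((Fin d → ZMod M) × ZMod M)) (lam : ℝ) (hlam : 0 ≤ lam)
    (hE : ∀ g ∈ E, lam ≤ ‖∑ n ∈ freqBox d N, a n * paraboloidChar M n g‖) :
    lam ^ 2 * E.card * ∑ q ∈ S, ((q - 1 : ℕ) : ℝ)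
      ≤ 16 * Q ^ 2 * w ^ d * E.card
        + 8 * Q * Fintype.card ((Fin d → ZMod M) × ZMod M) := by
  classical
  have hQ0 : 0 < Q := by omega
  have hJR : (0 : ℝ) < J := by exact_mod_cast hJ0
  have hMN : 2 * N < M := by
    rw [← hJ]
    calc 2 * N ≤ 2 * Q := by omega
      _ < 16 * Q := by omega
      _ ≤ 16 * Q * (Q * J) := Nat.le_mul_of_pos_right _ (by positivity)
      _ = 16 * Q ^ 2 * J := by ring
  obtain ⟨u, hu1, hu2⟩ := AddChar.sq_mul_card_sq_le (freqBox d N) (paraboloidChar M) a ha E lam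
    hlam hE
  set v : (Fin d → ZMod M) × ZMod M → ℂ := fun g => if g ∈ E then u g else 0 with hv
  have hvχ : ∀ n : Fin d → ℤ, ∑ g, v g * paraboloidChar M n g
      = ∑ g ∈ E, u g * paraboloidChar M n g := by
    intro n
    simp only [hv, ite_mul, zero_mul]
    rw [← Finset.sum_filter, Finset.filter_mem_eq_inter, Finset.univ_inter]
  have hv1 : ∑ g, ‖v g‖ ≤ E.card := by
    calc ∑ g, ‖v g‖ ≤ ∑ g, if g ∈ E then (1 : ℝ) else 0 := by
          refine Finset.sum_le_sum fun g _ => ?_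
          rw [hv]; dsimp only
          split_ifs with h
          · exact hu1 g h
          · simp
      _ = E.card := by simp
  have hv2 : ∑ g, ‖v g‖ ^ 2 ≤ E.card := by
    calc ∑ g, ‖v g‖ ^ 2 ≤ ∑ g, if g ∈ E then (1 : ℝ) else 0 := by
          refine Finset.sum_le_sum fun g _ => ?_
          rw [hv]; dsimp only
          split_ifs with h
          · exact pow_le_one₀ (norm_nonneg _) (hu1 g h)
          · simp
      _ = E.card := by simp
  have hB : ∀ g : (Fin d → ZMod M) × ZMod M, ‖(∑ n ∈ freqBox d N, paraboloidChar M n g) *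
      arcIndicator M S J (AddMonoidHom.snd (Fin d → ZMod M) (ZMod M) g)‖ ≤ w ^ d := by
    intro g
    rw [AddMonoidHom.coe_snd, arcIndicator]
    split_ifs with h
    · rw [mul_one, sum_paraboloidChar, norm_prod]
      obtain ⟨⟨q, b, i⟩, hs, hg⟩ := Finset.mem_image.1 h
      simp only [arcIndex, Finset.mem_sigma, Finset.mem_product, Finset.mem_Ico,
        Finset.mem_range] at hs
      obtain ⟨hq, ⟨hb1, hbq⟩, hi⟩ := hs
      calc _ ≤ ∏ _j : Fin d, w := by
            refine Finset.prod_le_prod (fun _ _ => norm_nonneg _) fun j _ => ?_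
            -- The kernel is a product of `d` one-dimensional quadratic sums, each controlled by
            -- Weyl's inequality on the arc.
            refine abs_le_of_sq_le_sq' ?_ hw0 |>.2
            refine le_trans ?_ (hw q hq)
            rw [← hg, arcPoint]
            refine ZMod.norm_sum_quadratic_sq_le (hS q hq) (hS2 q hq) (hM q hq) b i Q N (hQ q hq)
              hNQ ?_ hb1 hbq _
            rw [← hJ]
            have : 0 < 16 * Q ^ 2 := by positivity
            exact Nat.mul_lt_mul_of_pos_left hi this
        _ = w ^ d := by simp
    · rw [mul_zero, norm_zero]; positivity
  have key := AddChar.dft_zero_mul_sum_norm_sq_le (freqBox d N) (paraboloidChar M)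
    (AddMonoidHom.snd (Fin d → ZMod M) (ZMod M)) (arcIndicator M S J)
    (fun n hn n' hn' k k' h => paraboloidChar_injective hMN n hn n' hn' k k' h) v _ (w ^ d)
    (8 * Q * J) (dft_arcIndicator_zero hS hQ hM hJ hJ0) hB
    (norm_dft_arcIndicator_le hS hQ hM hJ hJ0 hR hQ0) (by positivity)
  simp_rw [hvχ] at key
  rcases E.eq_empty_or_nonempty with rfl | hne
  · simp; positivity
  have hEpos : (0 : ℝ) < E.card := by exact_mod_cast hne.card_pos
  have hMR : (M : ℝ) = 16 * Q ^ 2 * J := by rw [← hJ]; push_cast; ring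
  set A := ∑ q ∈ S, ((q - 1 : ℕ) : ℝ) with hA
  have hA0 : 0 ≤ A := by positivity
  have h1 : (J * A) * (lam * E.card) ^ 2 ≤ (16 * Q ^ 2 * J) * w ^ d * (E.card : ℝ) ^ 2
      + 8 * Q * J * (Fintype.card ((Fin d → ZMod M) × ZMod M) * E.card) := by
    calc (J * A) * (lam * E.card) ^ 2 ≤ (J * A) *
          ∑ n ∈ freqBox d N, ‖∑ g ∈ E, u g * paraboloidChar M n g‖ ^ 2 := by gcongr
      _ ≤ _ := key
      _ ≤ _ := by
        rw [hMR]
        gcongr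
  -- The common factor `J` cancels, so the estimate does not depend on how fine the grid is.
  have h2 : (J * E.card : ℝ) * (lam ^ 2 * E.card * A) ≤ (J * E.card : ℝ) *
      (16 * Q ^ 2 * w ^ d * E.card
        + 8 * Q * Fintype.card ((Fin d → ZMod M) × ZMod M)) := by linarith
  exact le_of_mul_le_mul_left h2 (by positivity)

/-- The `L²` bound on the finite grid. -/
theorem AddChar.sum_norm_sum_sq_le {G : Type*} [AddCommGroup G] [Fintype G] {ι : Type*}
    (S : Finset ι) (χ : ι → AddChar G ℂ) (hχ : Set.InjOn χ S) (a : ι → ℂ)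
    (ha : ∑ n ∈ S, ‖a n‖ ^ 2 ≤ 1) :
    ∑ g, ‖∑ n ∈ S, a n * χ n g‖ ^ 2 ≤ Fintype.card G := by
  set F : G → ℂ := fun g => ∑ n ∈ S, a n * χ n g with hF
  set X := ∑ g, ‖F g‖ ^ 2 with hX
  have hX0 : 0 ≤ X := by positivity
  have h2 : ((X : ℝ) : ℂ) = ∑ n ∈ S, a n * ∑ g, (starRingEnd ℂ) (F g) * χ n g := by
    rw [hX]
    push_cast
    simp_rw [← Complex.ofReal_pow, ← Complex.normSq_eq_norm_sq, ← Complex.mul_conj, Finset.mul_sum]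
    rw [Finset.sum_comm]
    refine Finset.sum_congr rfl fun g _ => ?_
    conv_lhs => enter [1]; rw [hF]
    dsimp only
    rw [Finset.sum_mul]
    exact Finset.sum_congr rfl fun n _ => by ring
  have h3 : X ≤ ∑ n ∈ S, ‖a n‖ * ‖∑ g, (starRingEnd ℂ) (F g) * χ n g‖ := by
    calc X = ‖(X : ℂ)‖ := by rw [Complex.norm_real, Real.norm_of_nonneg hX0]
      _ ≤ _ := by
          rw [h2]
          exact norm_sum_le_of_le _ fun n _ => (norm_mul _ _).le
  have h4 := AddChar.sum_norm_sq_le S χ hχ (fun g => (starRingEnd ℂ) (F g))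
  simp only [RCLike.norm_conj] at h4
  -- Cauchy–Schwarz and Bessel applied to the conjugate of `F` bound `X²` by a multiple of `X`
  -- itself, which is then divided out.
  have h5 : X ^ 2 ≤ Fintype.card G * X := by
    calc X ^ 2 ≤ (∑ n ∈ S, ‖a n‖ * ‖∑ g, (starRingEnd ℂ) (F g) * χ n g‖) ^ 2 := by gcongr
      _ ≤ (∑ n ∈ S, ‖a n‖ ^ 2) * ∑ n ∈ S, ‖∑ g, (starRingEnd ℂ) (F g) * χ n g‖ ^ 2 :=
          Finset.sum_mul_sq_le_sq_mul_sq _ _ _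
      _ ≤ 1 * (Fintype.card G * X) := by gcongr
      _ = _ := one_mul _
  rcases hX0.eq_or_lt with h | h
  · rw [← h]; positivity
  · rw [pow_two] at h5; exact le_of_mul_le_mul_right h5 h

/-! ### Supply of prime denominators and the large value estimate in powers of Q. -/

/-- The primes `q ≤ Q` with `Q^{1-δ} ≤ q`. -/
noncomputable def largePrimes (δ : ℝ) (Q : ℕ) : Finset ℕ :=
  (Finset.range (Q + 1)).filter fun q => q.Prime ∧ (Q : ℝ) ^ (1 - δ) ≤ q

theorem eventually_log_le_mul_rpow {δ : ℝ} (hδ : 0 < δ) (c : ℝ) (hc : 0 < c) :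
    ∀ᶠ Q : ℕ in Filter.atTop, Real.log Q ≤ c * (Q : ℝ) ^ δ := by
  have h := (isLittleO_log_rpow_atTop hδ).bound hc
  filter_upwards [tendsto_natCast_atTop_atTop.eventually h] with Q hQ
  refine (le_abs_self _).trans (hQ.trans ?_)
  rw [Real.norm_of_nonneg (by positivity)]

/-- With `R = Q^{1-δ}`, Chebyshev's lower bound gives at least `3R` primes up to `Q`. At most `R +
1` of them lie below `R`, so at least `R` remain, each contributing at least `R/2`. -/
theorem eventually_rpow_le_sum_largePrimes {δ : ℝ} (hδ : 0 < δ) (hδ1 : δ < 1) :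
    ∀ᶠ Q : ℕ in Filter.atTop, (∀ q ∈ largePrimes δ Q, 2 < q) ∧
      (Q : ℝ) ^ (2 - 2 * δ) / 2 ≤ ∑ q ∈ largePrimes δ Q, ((q - 1 : ℕ) : ℝ) := by
  have hlarge : ∀ᶠ Q : ℕ in Filter.atTop, (3 : ℝ) ≤ (Q : ℝ) ^ (1 - δ) :=
    (((tendsto_rpow_atTop (by linarith : 0 < 1 - δ)).comp
      tendsto_natCast_atTop_atTop).eventually_ge_atTop 3)
  filter_upwards [eventually_log_le_mul_rpow hδ (1 / 12) (by norm_num), hlarge,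
    Filter.eventually_ge_atTop 12] with Q hlog hR hQ
  set R : ℝ := (Q : ℝ) ^ (1 - δ) with hRdef
  have hQ' : (12 : ℝ) ≤ Q := by exact_mod_cast hQ
  have hQ0 : (0 : ℝ) < Q := by linarith
  have hQ1 : (1 : ℝ) ≤ Q := by linarith
  have hgt : ∀ q ∈ largePrimes δ Q, R ≤ q := fun q hq => (Finset.mem_filter.1 hq).2.2
  refine ⟨fun q hq => ?_, ?_⟩
  · have : (3 : ℝ) ≤ q := hR.trans (hgt q hq)
    have : 3 ≤ q := by exact_mod_cast this
    omega
  have hlogpos : 0 < Real.log Q := Real.log_pos (by linarith)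
  have hpi : 3 * R ≤ (Nat.primeCounting Q : ℝ) := by
    refine le_trans ?_ (Chebyshev.pi_ge Q)
    rw [le_div_iff₀ hlogpos]
    have h1 : 3 * R * Real.log Q ≤ Q / 4 := by
      calc 3 * R * Real.log Q ≤ 3 * R * (1 / 12 * (Q : ℝ) ^ δ) := by gcongr
        _ = (R * (Q : ℝ) ^ δ) / 4 := by ring
        _ = Q / 4 := by
          rw [hRdef, ← Real.rpow_add hQ0]; simp
    have h2 : Real.log (Q + 1) ≤ Q / 6 := by
      have e : (Q : ℝ) + 1 = Q * (1 + 1 / Q) := by field_simp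
      rw [e, Real.log_mul hQ0.ne' (by positivity)]
      have h3 : Real.log (1 + 1 / Q) ≤ 1 / Q := by
        have := Real.log_le_sub_one_of_pos (by positivity : (0 : ℝ) < 1 + 1 / Q)
        linarith
      have h4 : (1 : ℝ) / Q ≤ 1 := by rw [div_le_one hQ0]; exact hQ1
      have h5 : (Q : ℝ) ^ δ ≤ Q := by
        calc (Q : ℝ) ^ δ ≤ (Q : ℝ) ^ (1 : ℝ) := Real.rpow_le_rpow_of_exponent_le hQ1 hδ1.le
          _ = Q := Real.rpow_one _
      linarith
    have h6 : 0.69 < Real.log 2 := by linarith [Real.log_two_gt_d9]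
    nlinarith
  have hcard : (Nat.primeCounting Q : ℝ) ≤ (largePrimes δ Q).card + (R + 1) := by
    have h1 : Nat.primeCounting Q = ((Finset.range (Q + 1)).filter Nat.Prime).card := by
      rw [Nat.primeCounting, Nat.primeCounting', Nat.count_eq_card_filter_range]
    have h2 : (Finset.range (Q + 1)).filter Nat.Prime ⊆ largePrimes δ Q ∪ Finset.range ⌈R⌉₊ := by
      intro q hq
      rw [Finset.mem_filter] at hq
      rw [Finset.mem_union, largePrimes, Finset.mem_filter, Finset.mem_range (n := ⌈R⌉₊)]
      rcases le_or_gt R q with h | h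
      · exact Or.inl ⟨hq.1, hq.2, h⟩
      · exact Or.inr (Nat.lt_ceil.2 h)
    have h3 := (Finset.card_le_card h2).trans (Finset.card_union_le _ _)
    rw [Finset.card_range, ← h1] at h3
    have h4 : (Nat.primeCounting Q : ℝ) ≤ (largePrimes δ Q).card + (⌈R⌉₊ : ℝ) := by
      exact_mod_cast h3
    have h5 := (Nat.ceil_lt_add_one (by linarith : 0 ≤ R)).le
    linarith
  calc (Q : ℝ) ^ (2 - 2 * δ) / 2 = R * (R / 2) := by
        have : (Q : ℝ) ^ (2 - 2 * δ) = R * R := by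
          rw [hRdef, ← Real.rpow_add hQ0]; congr 1; ring
        rw [this]; ring
    _ ≤ (largePrimes δ Q).card * (R / 2) := by gcongr; linarith
    _ = ∑ q ∈ largePrimes δ Q, R / 2 := by simp
    _ ≤ _ := by
      refine Finset.sum_le_sum fun q hq => ?_
      have hq1 := hgt q hq
      have hqn : 1 ≤ q := (Finset.mem_filter.1 hq).2.1.pos
      rw [Nat.cast_sub hqn]
      push_cast
      linarith

/-- The large value estimate on the finite grid, with powers of `Q`. -/
theorem exists_sq_mul_card_le (d : ℕ) {δ : ℝ} (hδ : 0 < δ) (hδ1 : δ ≤ 1 / 5) :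
    ∃ C : ℝ, 1 ≤ C ∧ ∀ (Q N M : ℕ) [NeZero M], 1 ≤ N → N ≤ Q → 16 * Q ^ 2 ∣ M →
      (∀ q, 0 < q → q ≤ Q → q ∣ M) → ∀ a : (Fin d → ℤ) → ℂ, ∑ n ∈ freqBox d N, ‖a n‖ ^ 2 ≤ 1 →
      ∀ (E : Finset ((Fin d → ZMod M) × ZMod M)) (lam : ℝ), 0 ≤ lam →
      (∀ g ∈ E, lam ≤ ‖∑ n ∈ freqBox d N, a n * paraboloidChar M n g‖) →
      C * (Q : ℝ) ^ ((d : ℝ) / 2 + (d + 2) * δ) ≤ lam ^ 2 →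
      lam ^ 2 * E.card ≤ C * (Q : ℝ) ^ (-1 + 2 * δ)
        * Fintype.card ((Fin d → ZMod M) × ZMod M) := by
  obtain ⟨Q0, hQ0⟩ := Filter.eventually_atTop.1
    ((eventually_rpow_le_sum_largePrimes hδ (by linarith)).and
      (eventually_log_le_mul_rpow hδ (1 / 12) (by norm_num)))
  -- `Q0 + 1` handles small `Q`, where the L² bound suffices because `C Q⁻¹ ≥ 1`; `64 * 6 ^ d` is
  -- what absorbing the Weyl term requires.
  refine ⟨max (Q0 + 1) (64 * 6 ^ d), le_max_of_le_left (by linarith [Nat.cast_nonneg (α := ℝ) Q0]),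
    ?_⟩
  intro Q N M _ hN hNQ hQM hqM a ha E lam hlam hE hClam
  set C : ℝ := max (Q0 + 1) (64 * 6 ^ d) with hC
  generalize hG : (Fintype.card ((Fin d → ZMod M) × ZMod M) : ℝ) = G
  have hG0 : 0 ≤ G := hG ▸ Nat.cast_nonneg _
  have hQpos : 0 < Q := by omega
  have hQR : (0 : ℝ) < Q := by exact_mod_cast hQpos
  have hQ1 : (1 : ℝ) ≤ Q := by exact_mod_cast hQpos
  obtain ⟨J, hJ⟩ := hQM
  have hJ0 : 0 < J := Nat.pos_of_ne_zero fun h => NeZero.ne M (by rw [hJ, h, mul_zero])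
  rcases lt_or_ge Q Q0 with hlt | hge
  · have hMN : 2 * N < M := by
      rw [hJ]
      calc 2 * N ≤ 2 * Q := by omega
        _ < 16 * Q := by omega
        _ ≤ 16 * Q * (Q * J) := Nat.le_mul_of_pos_right _ (by positivity)
        _ = 16 * Q ^ 2 * J := by ring
    have h1 := AddChar.sum_norm_sum_sq_le (freqBox d N) (paraboloidChar M)
      (paraboloidChar_injOn hMN) a ha
    rw [hG] at h1
    have h2 : lam ^ 2 * E.card ≤ G := by
      calc lam ^ 2 * E.card = ∑ g ∈ E, lam ^ 2 := by simp [mul_comm]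
        _ ≤ ∑ g ∈ E, ‖∑ n ∈ freqBox d N, a n * paraboloidChar M n g‖ ^ 2 := by
          refine Finset.sum_le_sum fun g hg => ?_
          exact pow_le_pow_left₀ hlam (hE g hg) 2
        _ ≤ ∑ g, ‖∑ n ∈ freqBox d N, a n * paraboloidChar M n g‖ ^ 2 :=
          Finset.sum_le_univ_sum_of_nonneg fun _ => by positivity
        _ ≤ _ := h1
    have h3 : 1 ≤ C * (Q : ℝ) ^ (-1 + 2 * δ) := by
      have h4 : (Q : ℝ) ^ (-1 : ℝ) ≤ (Q : ℝ) ^ (-1 + 2 * δ) :=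
        Real.rpow_le_rpow_of_exponent_le hQ1 (by linarith)
      rw [Real.rpow_neg_one] at h4
      have h5 : (Q : ℝ) ≤ C := by
        have : (Q : ℝ) ≤ Q0 := by exact_mod_cast hlt.le
        exact (this.trans (by linarith)).trans (le_max_left _ _)
      calc (1 : ℝ) = Q * (Q : ℝ)⁻¹ := by field_simp
        _ ≤ C * (Q : ℝ) ^ (-1 + 2 * δ) := by gcongr
    calc _ ≤ 1 * G := by rw [one_mul]; exact h2
      _ ≤ _ := by gcongr
  · obtain ⟨⟨hS2, hA⟩, hlog⟩ := hQ0 Q hge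
    set S := largePrimes δ Q with hS
    have hSR : ∀ q ∈ S, (Q : ℝ) ^ (1 - δ) ≤ q := fun q hq => (Finset.mem_filter.1 hq).2.2
    have hSp : ∀ q ∈ S, q.Prime := fun q hq => (Finset.mem_filter.1 hq).2.1
    have hSQ : ∀ q ∈ S, q ≤ Q := fun q hq => by
      have := Finset.mem_range.1 (Finset.mem_filter.1 hq).1; omega
    have hS5 : ∀ q ∈ S, Q ^ 4 ≤ q ^ 5 := by
      intro q hq
      have : (Q : ℝ) ^ 4 ≤ (q : ℝ) ^ 5 := by
        calc (Q : ℝ) ^ 4 = (Q : ℝ) ^ (4 : ℝ) := by norm_cast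
          _ ≤ (Q : ℝ) ^ ((1 - δ) * 5) := Real.rpow_le_rpow_of_exponent_le hQ1 (by linarith)
          _ = ((Q : ℝ) ^ (1 - δ)) ^ 5 := by
            rw [Real.rpow_mul hQR.le]; norm_cast
          _ ≤ (q : ℝ) ^ 5 := by gcongr; exact hSR q hq
      exact_mod_cast this
    set w : ℝ := 6 * (Q : ℝ) ^ ((1 + 2 * δ) / 2) with hw
    have hw2 : w ^ 2 = 36 * (Q : ℝ) ^ (1 + 2 * δ) := by
      rw [hw, mul_pow, ← Real.rpow_natCast ((Q : ℝ) ^ _), ← Real.rpow_mul hQR.le]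
      norm_num
    have hwd : w ^ d = 6 ^ d * (Q : ℝ) ^ ((d : ℝ) / 2 + d * δ) := by
      rw [hw, mul_pow, ← Real.rpow_natCast (n := d) (x := (Q : ℝ) ^ _), ← Real.rpow_mul hQR.le]
      congr 2
      ring
    have hQδ : 1 ≤ (Q : ℝ) ^ δ := Real.one_le_rpow hQ1 hδ.le
    have hww : ∀ q ∈ S, ((4 * N + 1) / q + 1) * (2 * N + 1 + 2 * q * (1 + Real.log q))
        ≤ w ^ 2 := by
      intro q hq
      have hq0 : (0 : ℝ) < q := by exact_mod_cast (hSp q hq).pos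
      have hqQ : (q : ℝ) ≤ Q := by exact_mod_cast hSQ q hq
      have hNQ' : (N : ℝ) ≤ Q := by exact_mod_cast hNQ
      have hRpos : (0 : ℝ) < (Q : ℝ) ^ (1 - δ) := by positivity
      have h1 : ((4 * N + 1) / q + 1 : ℝ) ≤ 6 * (Q : ℝ) ^ δ := by
        have : ((4 * N + 1) / q : ℝ) ≤ 5 * (Q : ℝ) ^ δ := by
          calc ((4 * N + 1) / q : ℝ) ≤ (5 * Q) / (Q : ℝ) ^ (1 - δ) := by
                gcongr
                · linarith
                · exact hSR q hq
            _ = 5 * (Q : ℝ) ^ δ := by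
              have : (Q : ℝ) = (Q : ℝ) ^ δ * (Q : ℝ) ^ (1 - δ) := by
                rw [← Real.rpow_add hQR]; simp
              nth_rewrite 1 [this]
              field_simp
        linarith
      have h2 : (2 * N + 1 + 2 * q * (1 + Real.log q) : ℝ) ≤ 6 * (Q * (Q : ℝ) ^ δ) := by
        have hlq : Real.log q ≤ 1 / 12 * (Q : ℝ) ^ δ := le_trans (Real.log_le_log hq0 hqQ) hlog
        have hlq0 : 0 ≤ Real.log q := Real.log_natCast_nonneg q
        calc (2 * N + 1 + 2 * q * (1 + Real.log q) : ℝ)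
            ≤ 2 * Q + Q + 2 * Q * (1 + 1 / 12 * (Q : ℝ) ^ δ) := by gcongr
          _ = 5 * (Q * 1) + (1 / 6) * (Q * (Q : ℝ) ^ δ) := by ring
          _ ≤ 5 * (Q * (Q : ℝ) ^ δ) + 1 * (Q * (Q : ℝ) ^ δ) := by gcongr; norm_num
          _ = _ := by ring
      have h0 : (0 : ℝ) ≤ 2 * N + 1 + 2 * q * (1 + Real.log q) := by
        have hlq0 : 0 ≤ Real.log q := Real.log_natCast_nonneg q
        positivity
      calc _ ≤ 6 * (Q : ℝ) ^ δ * (6 * (Q * (Q : ℝ) ^ δ)) := by gcongr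
        _ = w ^ 2 := by
          rw [hw2, Real.rpow_add hQR, Real.rpow_one, two_mul δ, Real.rpow_add hQR]
          ring
    have key := sq_mul_card_mul_le hSp hSQ (fun q hq => hqM q (hSp q hq).pos (hSQ q hq)) hJ.symm hJ0
      hS5 hS2 hN hNQ w (by positivity) hww a ha E lam hlam hE
    rw [hG] at key
    set A := ∑ q ∈ S, ((q - 1 : ℕ) : ℝ) with hAdef
    have hApos : 0 < A := lt_of_lt_of_le (by positivity) hA
    -- The lower bound on `lam ^ 2` makes the Weyl term at most half of the left side of `key`.
    have h1 : 16 * (Q : ℝ) ^ 2 * w ^ d ≤ lam ^ 2 * A / 2 := by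
      have h2 : 64 * 6 ^ d * (Q : ℝ) ^ ((d : ℝ) / 2 + (d + 2) * δ) * ((Q : ℝ) ^ (2 - 2 * δ) / 2)
          ≤ lam ^ 2 * A := by
        refine mul_le_mul (le_trans ?_ hClam) hA (by positivity) (by positivity)
        gcongr
        exact le_max_right _ _
      have h3 : (Q : ℝ) ^ ((d : ℝ) / 2 + (d + 2) * δ) * (Q : ℝ) ^ (2 - 2 * δ)
          = (Q : ℝ) ^ 2 * (Q : ℝ) ^ ((d : ℝ) / 2 + d * δ) := by
        rw [← Real.rpow_natCast, ← Real.rpow_add hQR, ← Real.rpow_add hQR]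
        congr 1
        push_cast
        ring
      rw [hwd]
      have h4 : 64 * 6 ^ d * (Q : ℝ) ^ ((d : ℝ) / 2 + (d + 2) * δ) * ((Q : ℝ) ^ (2 - 2 * δ) / 2)
          = 32 * 6 ^ d * ((Q : ℝ) ^ 2 * (Q : ℝ) ^ ((d : ℝ) / 2 + d * δ)) := by
        rw [← h3]; ring
      rw [h4] at h2
      linarith
    have h2 : lam ^ 2 * E.card * A ≤ 16 * Q * G := by
      have := mul_le_mul_of_nonneg_right h1 (Nat.cast_nonneg (α := ℝ) E.card)
      linarith
    have hfin : lam ^ 2 * E.card * ((Q : ℝ) ^ (2 - 2 * δ) / 2) ≤ 16 * Q * G :=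
      le_trans (by gcongr) h2
    have h5 : (Q : ℝ) ^ (-1 + 2 * δ) * (Q : ℝ) ^ (2 - 2 * δ) = Q := by
      rw [← Real.rpow_add hQR]; ring_nf; simp
    have h6 : (64 : ℝ) ≤ C := by
      refine le_trans ?_ (le_max_right _ _)
      have : (1 : ℝ) ≤ 6 ^ d := one_le_pow₀ (by norm_num)
      linarith
    have hpos : (0 : ℝ) < (Q : ℝ) ^ (2 - 2 * δ) / 2 := by positivity
    refine le_of_mul_le_mul_right (hfin.trans ?_) hpos
    have h7 : C * (Q : ℝ) ^ (-1 + 2 * δ) * G * ((Q : ℝ) ^ (2 - 2 * δ) / 2)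
        = C / 2 * Q * G := by
      calc _ = C / 2 * ((Q : ℝ) ^ (-1 + 2 * δ) * (Q : ℝ) ^ (2 - 2 * δ)) * G := by ring
        _ = _ := by rw [h5]
    rw [h7]
    gcongr
    linarith

/-! ### Summation over level sets. -/

theorem card_freqBox_le {d N : ℕ} (hN : 1 ≤ N) : ((freqBox d N).card : ℝ) ≤ (3 * N : ℝ) ^ d := by
  rw [freqBox, Fintype.card_piFinset]
  simp only [Int.card_Icc, Finset.prod_const, Finset.card_univ, Fintype.card_fin]
  have : (N + 1 - -(N : ℤ)).toNat ≤ 3 * N := by omega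
  exact_mod_cast Nat.pow_le_pow_left this d

theorem norm_sum_mul_sq_le {d N : ℕ} (hN : 1 ≤ N) (a b : (Fin d → ℤ) → ℂ)
    (ha : ∑ n ∈ freqBox d N, ‖a n‖ ^ 2 ≤ 1) (hb : ∀ n, ‖b n‖ = 1) :
    ‖∑ n ∈ freqBox d N, a n * b n‖ ^ 2 ≤ (3 * N : ℝ) ^ d := by
  calc _ ≤ (∑ n ∈ freqBox d N, ‖a n‖ * 1) ^ 2 := by
        gcongr
        exact norm_sum_le_of_le _ fun n _ => by rw [norm_mul, hb]
    _ ≤ (∑ n ∈ freqBox d N, ‖a n‖ ^ 2) * ∑ n ∈ freqBox d N, (1 : ℝ) ^ 2 :=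
        Finset.sum_mul_sq_le_sq_mul_sq _ _ _
    _ ≤ 1 * (3 * N : ℝ) ^ d := by
        gcongr
        simpa using card_freqBox_le hN
    _ = _ := one_mul _

theorem norm_paraboloidChar {M : ℕ} [NeZero M] {d : ℕ} (n : Fin d → ℤ)
    (g : (Fin d → ZMod M) × ZMod M) : ‖paraboloidChar M n g‖ = 1 := by
  rw [paraboloidChar_apply, ZMod.norm_stdAddChar]

theorem exists_layer (L : ℕ → ℝ) (v : ℝ) (J : ℕ) (h : v ≤ L J) :
    v ≤ L 0 ∨ ∃ j < J, L j ≤ v ∧ v ≤ L (j + 1) := by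
  induction J with
  | zero => exact Or.inl h
  | succ J ih =>
    rcases le_total v (L J) with h' | h'
    · rcases ih h' with h0 | ⟨j, hj, hh⟩
      · exact Or.inl h0
      · exact Or.inr ⟨j, by omega, hh⟩
    · exact Or.inr ⟨J, by omega, h', h⟩

/-- For `s ≥ 1` the ratio is at least 2, so the next term dominates the whole sum without a
constant. -/
theorem sum_two_pow_rpow_le {s : ℝ} (hs : 1 ≤ s) (J : ℕ) :
    ∑ j ∈ Finset.range J, ((2 : ℝ) ^ j) ^ s ≤ ((2 : ℝ) ^ J) ^ s := by
  induction J with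
  | zero => simp
  | succ J ih =>
    rw [Finset.sum_range_succ, pow_succ, Real.mul_rpow (by positivity) (by norm_num)]
    have : (2 : ℝ) ≤ 2 ^ s := by
      calc (2 : ℝ) = 2 ^ (1 : ℝ) := (Real.rpow_one 2).symm
        _ ≤ _ := Real.rpow_le_rpow_of_exponent_le (by norm_num) hs
    have h0 : (0 : ℝ) ≤ ((2 : ℝ) ^ J) ^ s := by positivity
    nlinarith

/-- The layer cake bound used to sum large value estimates. -/
theorem sum_rpow_le_of_layers {G : Type*} [Fintype G] (v : G → ℝ) (hv : ∀ g, 0 ≤ v g)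
    (L : ℕ → ℝ) (hL : ∀ j, 0 ≤ L j) (J : ℕ) (hJ : ∀ g, v g ≤ L J) (r : ℝ) (hr : 0 ≤ r) :
    ∑ g, v g ^ (1 + r) ≤ L 0 ^ r * ∑ g, v g + ∑ j ∈ Finset.range J,
      L (j + 1) ^ (1 + r) * ((Finset.univ.filter fun g => L j ≤ v g).card : ℝ) := by
  have h1 : ∀ g, v g ^ (1 + r) ≤ L 0 ^ r * v g + ∑ j ∈ Finset.range J,
      L (j + 1) ^ (1 + r) * (if L j ≤ v g then (1 : ℝ) else 0) := by
    intro g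
    have hnn : ∀ j ∈ Finset.range J,
        0 ≤ L (j + 1) ^ (1 + r) * (if L j ≤ v g then (1 : ℝ) else 0) := fun j _ => by
      have := Real.rpow_nonneg (hL (j + 1)) (1 + r)
      split_ifs <;> simp [this]
    have h0 : 0 ≤ L 0 ^ r * v g := mul_nonneg (Real.rpow_nonneg (hL 0) r) (hv g)
    rcases exists_layer L (v g) J (hJ g) with h | ⟨j, hj, hj1, hj2⟩
    · have : v g ^ (1 + r) ≤ L 0 ^ r * v g := by
        rw [Real.rpow_add_of_nonneg (hv g) zero_le_one hr, Real.rpow_one, mul_comm]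
        exact mul_le_mul_of_nonneg_right (Real.rpow_le_rpow (hv g) h hr) (hv g)
      linarith [Finset.sum_nonneg hnn]
    · have h2 := Finset.single_le_sum hnn (Finset.mem_range.2 hj)
      rw [if_pos hj1, mul_one] at h2
      have h3 : v g ^ (1 + r) ≤ L (j + 1) ^ (1 + r) := Real.rpow_le_rpow (hv g) hj2 (by linarith)
      linarith
  calc _ ≤ ∑ g, (L 0 ^ r * v g + ∑ j ∈ Finset.range J,
          L (j + 1) ^ (1 + r) * (if L j ≤ v g then (1 : ℝ) else 0)) :=
        Finset.sum_le_sum fun g _ => h1 g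
    _ = _ := by
        rw [Finset.sum_add_distrib, ← Finset.mul_sum, Finset.sum_comm]
        simp_rw [← Finset.mul_sum]
        simp

/-- The discrete Strichartz estimate at the endpoint exponent on a suitable finite grid. -/
theorem exists_grid_sum_rpow_le (d : ℕ) (hd : 1 ≤ d) {η : ℝ} (hη : 0 < η) :
    ∃ C : ℝ, 1 ≤ C ∧ ∀ N : ℕ, 1 ≤ N → ∃ M : ℕ, ∃ _ : NeZero M, ∀ a : (Fin d → ℤ) → ℂ,
      ∑ n ∈ freqBox d N, ‖a n‖ ^ 2 ≤ 1 →
      ∑ g, (‖∑ n ∈ freqBox d N, a n * paraboloidChar M n g‖ ^ 2) ^ (1 + 4 / d : ℝ)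
        ≤ C * (N : ℝ) ^ (2 + η) * Fintype.card ((Fin d → ZMod M) × ZMod M) := by
  -- `2s = 2 + 2(4 + 8/d)δ + 4δ ≤ 2 + 28δ` since `d ≥ 1`; the cap `1/5` is inherited from the large
  -- value estimate.
  set δ : ℝ := min (1 / 5) (η / 28) with hδdef
  have hδ : 0 < δ := lt_min (by norm_num) (by linarith)
  have hδη : 28 * δ ≤ η := by
    have := min_le_right (1 / 5 : ℝ) (η / 28)
    rw [← hδdef] at this
    linarith
  obtain ⟨C, hC1, hC⟩ := exists_sq_mul_card_le d hδ (min_le_left _ _)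
  have hd1 : (1 : ℝ) ≤ d := by exact_mod_cast hd
  have hd0 : (0 : ℝ) < d := by linarith
  have hC0 : 0 < C := by linarith
  set θ : ℝ := (d : ℝ) / 2 + (d + 2) * δ with hθ
  have hθ0 : 0 ≤ θ := by positivity
  set r : ℝ := 4 / d with hr
  have hr0 : 0 < r := by positivity
  set s : ℝ := θ * r + (-1 + 2 * δ) with hs
  have hθr : θ * r = 2 + (4 + 8 / d) * δ := by
    rw [hθ, hr]; field_simp; ring
  have h8 : 8 / (d : ℝ) ≤ 8 := by rw [div_le_iff₀ hd0]; linarith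
  have h80 : 0 < 8 / (d : ℝ) := by positivity
  have hs1 : 1 ≤ s := by
    rw [hs, hθr]
    have : 0 ≤ (4 + 8 / (d : ℝ)) * δ := by positivity
    linarith
  have hs2 : 2 * s ≤ 2 + η := by
    rw [hs, hθr]
    have : (4 + 8 / (d : ℝ)) * δ ≤ 12 * δ := by gcongr; linarith
    linarith
  have hs3 : θ * r ≤ 2 * s := by
    rw [hs, hθr]
    have : 0 ≤ (4 + 8 / (d : ℝ)) * δ := by positivity
    linarith
  set K : ℝ := (2 ^ θ * C) ^ r * (2 ^ θ * C) with hK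
  have h2θ : (1 : ℝ) ≤ 2 ^ θ := Real.one_le_rpow (by norm_num) hθ0
  have h2C : (1 : ℝ) ≤ 2 ^ θ * C := one_le_mul_of_one_le_of_one_le h2θ hC1
  have hKr : (1 : ℝ) ≤ (2 ^ θ * C) ^ r := Real.one_le_rpow h2C hr0.le
  have hK1 : 1 ≤ K := one_le_mul_of_one_le_of_one_le hKr h2C
  have h18 : (0 : ℝ) ≤ 18 ^ s := by positivity
  refine ⟨K * (1 + 18 ^ s), one_le_mul_of_one_le_of_one_le hK1 (by linarith), fun N hN => ?_⟩
  have hN1 : (1 : ℝ) ≤ N := by exact_mod_cast hN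
  have hN0 : (0 : ℝ) < N := by linarith
  -- `2^J N ≥ (3N)²` puts the top level above the Cauchy–Schwarz bound `(3N)^d`; the upper bound
  -- keeps the largest `Q` of order N².
  obtain ⟨J, hJ1, hJ2⟩ : ∃ J : ℕ, (9 * N : ℝ) ≤ 2 ^ J ∧ (2 : ℝ) ^ J ≤ 18 * N := by
    obtain ⟨m, hm1, hm2⟩ := exists_nat_pow_near (by linarith : (1 : ℝ) ≤ 9 * N) (one_lt_two)
    exact ⟨m + 1, hm2.le, by rw [pow_succ]; linarith⟩
  set X : ℕ := 2 ^ J * N with hX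
  -- One modulus serves all levels: it is divisible by `16Q²` for each `Q = 2^j N` with `j ≤ J`, and
  -- by every positive integer up to that `Q`.
  set M : ℕ := 16 * X.factorial ^ 2 with hM
  have hMpos : M ≠ 0 := by
    have := Nat.factorial_ne_zero X
    positivity
  have hMz : NeZero M := ⟨hMpos⟩
  refine ⟨M, hMz, fun a ha => ?_⟩
  set L : ℕ → ℝ := fun j => C * ((2 : ℝ) ^ j * N) ^ θ with hL
  have hL0 : ∀ j, 0 ≤ L j := fun j => by positivity
  set v : (Fin d → ZMod M) × ZMod M → ℝ := fun g =>
    ‖∑ n ∈ freqBox d N, a n * paraboloidChar M n g‖ ^ 2 with hv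
  have hv0 : ∀ g, 0 ≤ v g := fun g => by positivity
  have hLJ : ∀ g, v g ≤ L J := by
    intro g
    calc v g ≤ (3 * N : ℝ) ^ d := norm_sum_mul_sq_le hN a _ ha fun n => norm_paraboloidChar n g
      _ = ((3 * N : ℝ) ^ (2 : ℕ)) ^ ((d : ℝ) / 2) := by
        rw [← Real.rpow_natCast (n := 2), ← Real.rpow_mul (by positivity), ← Real.rpow_natCast]
        congr 1; push_cast; ring
      _ ≤ ((2 : ℝ) ^ J * N) ^ ((d : ℝ) / 2) := by
        gcongr
        nlinarith
      _ ≤ ((2 : ℝ) ^ J * N) ^ θ := by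
        refine Real.rpow_le_rpow_of_exponent_le ?_ ?_
        · exact one_le_mul_of_one_le_of_one_le (one_le_pow₀ (by norm_num)) hN1
        · rw [hθ]; linarith [show 0 ≤ ((d : ℝ) + 2) * δ by positivity]
      _ = 1 * ((2 : ℝ) ^ J * N) ^ θ := (one_mul _).symm
      _ ≤ L J := by rw [hL]; dsimp only; gcongr
  have hfac : ∀ j ≤ J, ∀ q, 0 < q → q ≤ 2 ^ j * N → q ∣ X.factorial := by
    intro j hj q hq0 hq
    refine Nat.dvd_factorial hq0 (hq.trans ?_)
    rw [hX]
    gcongr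
    norm_num
  generalize hG : (Fintype.card ((Fin d → ZMod M) × ZMod M) : ℝ) = G
  have hG0 : 0 ≤ G := hG ▸ Nat.cast_nonneg _
  have hsum : ∑ g, v g ≤ G := by
    rw [← hG]
    refine AddChar.sum_norm_sum_sq_le (freqBox d N) (paraboloidChar M) (paraboloidChar_injOn ?_) a ha
    have h1 : N ≤ X := by rw [hX]; exact Nat.le_mul_of_pos_left _ (by positivity)
    have h2 := Nat.self_le_factorial X
    have h3 := Nat.le_self_pow (n := 2) (by norm_num) X.factorial
    omega
  have hlayer : ∀ j ∈ Finset.range J,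
      L (j + 1) ^ (1 + r) * ((Finset.univ.filter fun g => L j ≤ v g).card : ℝ)
        ≤ K * G * ((N : ℝ) ^ s * ((2 : ℝ) ^ j) ^ s) := by
    intro j hj
    have hjJ : j ≤ J := (Finset.mem_range.1 hj).le
    set E := Finset.univ.filter fun g => L j ≤ v g with hE
    set Y : ℝ := (2 : ℝ) ^ j * N with hY
    have hYpos : 0 < Y := by positivity
    have hYc : ((2 ^ j * N : ℕ) : ℝ) = Y := by push_cast; rfl
    have hNX : N ≤ 2 ^ j * N := Nat.le_mul_of_pos_left _ (by positivity)
    have hmain := hC (2 ^ j * N) N M hN hNX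
      (by
        rw [hM]
        exact Nat.mul_dvd_mul_left 16 (pow_dvd_pow_of_dvd (hfac j hjJ _ (by omega) le_rfl) 2))
      (fun q hq0 hq => by
        rw [hM, pow_two]
        exact Dvd.dvd.mul_left (Dvd.dvd.mul_left (hfac j hjJ q hq0 hq) _) _)
      a ha E (Real.sqrt (L j)) (Real.sqrt_nonneg _)
      (fun g hg => by
        rw [hE, Finset.mem_filter] at hg
        exact Real.sqrt_le_iff.2 ⟨norm_nonneg _, hg.2⟩)
      (by rw [Real.sq_sqrt (hL0 j), hYc])
    rw [Real.sq_sqrt (hL0 j), hYc, hG] at hmain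
    have hLs : L (j + 1) = 2 ^ θ * L j := by
      simp only [hL]
      rw [pow_succ, mul_right_comm, Real.mul_rpow (by positivity) (by norm_num)]
      ring
    have hLr : L (j + 1) ^ r = (2 ^ θ * C) ^ r * Y ^ (θ * r) := by
      rw [hLs, Real.rpow_mul hYpos.le, ← Real.mul_rpow (by positivity) (by positivity)]
      congr 1
      simp only [hL]
      ring
    calc L (j + 1) ^ (1 + r) * (E.card : ℝ)
        = L (j + 1) ^ r * 2 ^ θ * (L j * E.card) := by
          rw [Real.rpow_add_of_nonneg (hL0 _) zero_le_one hr0.le, Real.rpow_one]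
          nth_rewrite 1 [hLs]
          ring
      _ ≤ L (j + 1) ^ r * 2 ^ θ * (C * Y ^ (-1 + 2 * δ) * G) := by
          have := Real.rpow_nonneg (hL0 (j + 1)) r
          gcongr
      _ = K * G * Y ^ s := by
          have hYs : Y ^ s = Y ^ (θ * r) * Y ^ (-1 + 2 * δ) := by rw [hs, Real.rpow_add hYpos]
          rw [hLr, hYs, hK]; ring
      _ = _ := by
          rw [hY, Real.mul_rpow (by positivity) hN0.le]; ring
  have hNs : (N : ℝ) ^ (2 * s) = (N : ℝ) ^ s * (N : ℝ) ^ s := by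
    rw [two_mul, Real.rpow_add hN0]
  calc ∑ g, v g ^ (1 + r) ≤ L 0 ^ r * ∑ g, v g + ∑ j ∈ Finset.range J,
        L (j + 1) ^ (1 + r) * ((Finset.univ.filter fun g => L j ≤ v g).card : ℝ) :=
        sum_rpow_le_of_layers v hv0 L hL0 J hLJ r hr0.le
    _ ≤ L 0 ^ r * G + ∑ j ∈ Finset.range J, K * G * ((N : ℝ) ^ s * ((2 : ℝ) ^ j) ^ s) := by
        have := Real.rpow_nonneg (hL0 0) r
        exact add_le_add (by gcongr) (Finset.sum_le_sum hlayer)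
    _ = L 0 ^ r * G + K * G * ((N : ℝ) ^ s * ∑ j ∈ Finset.range J, ((2 : ℝ) ^ j) ^ s) := by
        rw [← Finset.mul_sum, ← Finset.mul_sum]
    _ ≤ K * (N : ℝ) ^ (2 * s) * G + K * G * ((N : ℝ) ^ s * (18 ^ s * (N : ℝ) ^ s)) := by
        have h1 : L 0 ^ r ≤ K * (N : ℝ) ^ (2 * s) := by
          have e : L 0 ^ r = C ^ r * (N : ℝ) ^ (θ * r) := by
            simp only [hL]
            rw [pow_zero, one_mul, Real.mul_rpow hC0.le (by positivity), ← Real.rpow_mul hN0.le]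
          rw [e]
          have h3 : C ^ r ≤ K := by
            calc C ^ r ≤ (2 ^ θ * C) ^ r := by
                  gcongr
                  exact le_mul_of_one_le_left hC0.le h2θ
              _ ≤ K := le_mul_of_one_le_right (by positivity) h2C
          have h4 := Real.rpow_le_rpow_of_exponent_le hN1 hs3
          gcongr
        have h2 : ∑ j ∈ Finset.range J, ((2 : ℝ) ^ j) ^ s ≤ 18 ^ s * (N : ℝ) ^ s := by
          rw [← Real.mul_rpow (by norm_num) hN0.le]
          refine (sum_two_pow_rpow_le hs1 J).trans ?_
          gcongr
        gcongr
    _ = K * (1 + 18 ^ s) * (N : ℝ) ^ (2 * s) * G := by rw [hNs]; ring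
    _ ≤ K * (1 + 18 ^ s) * (N : ℝ) ^ (2 + η) * G := by
        have := Real.rpow_le_rpow_of_exponent_le hN1 hs2
        gcongr

/-- The discrete Strichartz estimate on a suitable finite grid, uniformly in the exponent. -/
theorem exists_grid_sum_norm_rpow_le (d : ℕ) (hd : 1 ≤ d) {ε : ℝ} (hε : 0 < ε) :
    ∃ C : ℝ, 0 < C ∧ ∀ p : ℝ, 2 * ((d : ℝ) + 4) / d < p → ∀ N : ℕ, 1 ≤ N →
      ∃ M : ℕ, ∃ _ : NeZero M, ∀ a : (Fin d → ℤ) → ℂ, ∑ n ∈ freqBox d N, ‖a n‖ ^ 2 ≤ 1 →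
      ∑ g, ‖∑ n ∈ freqBox d N, a n * paraboloidChar M n g‖ ^ p
        ≤ (C * (N : ℝ) ^ ((d : ℝ) / 2 - ((d : ℝ) + 2) / p + ε)) ^ p
          * Fintype.card ((Fin d → ZMod M) × ZMod M) := by
  obtain ⟨C, hC1, hC⟩ := exists_grid_sum_rpow_le d hd hε
  refine ⟨C * 3 ^ d, by positivity, fun p hp N hN => ?_⟩
  obtain ⟨M, hM, h⟩ := hC N hN
  refine ⟨M, hM, fun a ha => ?_⟩
  have hd1 : (1 : ℝ) ≤ d := by exact_mod_cast hd
  have hd0 : (0 : ℝ) < d := by linarith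
  have hN1 : (1 : ℝ) ≤ N := by exact_mod_cast hN
  have hN0 : (0 : ℝ) < N := by linarith
  have hp' : 2 + 2 * (4 / d : ℝ) < p := by
    have : 2 * ((d : ℝ) + 4) / d = 2 + 2 * (4 / d) := by field_simp
    linarith
  have h4 : 0 < (4 / d : ℝ) := by positivity
  have hp1 : 1 ≤ p := by linarith
  have hp0 : 0 < p := by linarith
  -- `e` is the excess over the endpoint, paid for by the supremum bound. The powers of N match
  -- exactly, `de + 2 = dp/2 - (d + 2)`, and `p ≥ 1` gives `C ≤ C^p` and `ε ≤ εp`, so the constant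
  -- is uniform in `p`.
  set e : ℝ := p / 2 - (1 + 4 / d) with he
  have he0 : 0 ≤ e := by rw [he]; linarith
  have hde : d * e = d * p / 2 - d - 4 := by rw [he]; field_simp; ring
  have h1 : ∀ g : (Fin d → ZMod M) × ZMod M,
      ‖∑ n ∈ freqBox d N, a n * paraboloidChar M n g‖ ^ p ≤
      (3 * N : ℝ) ^ (d * e) *
        (‖∑ n ∈ freqBox d N, a n * paraboloidChar M n g‖ ^ 2) ^ (1 + 4 / d : ℝ) := by
    intro g
    have hb := norm_sum_mul_sq_le hN a (fun n => paraboloidChar M n g) ha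
      fun n => norm_paraboloidChar n g
    set y := ‖∑ n ∈ freqBox d N, a n * paraboloidChar M n g‖
    have hy : 0 ≤ y := norm_nonneg _
    have e1 : y ^ p = (y ^ 2) ^ (e + (1 + 4 / d)) := by
      rw [← Real.rpow_natCast, ← Real.rpow_mul hy, he]; congr 1; push_cast; ring
    rw [e1, Real.rpow_add_of_nonneg (by positivity) he0 (by positivity), Real.rpow_mul (by positivity),
      Real.rpow_natCast]
    gcongr
  have hs : ∑ g, ‖∑ n ∈ freqBox d N, a n * paraboloidChar M n g‖ ^ p
      ≤ (3 * N : ℝ) ^ (d * e) * (C * (N : ℝ) ^ (2 + ε) * Fintype.card ((Fin d → ZMod M) × ZMod M)) := by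
    refine (Finset.sum_le_sum fun g _ => h1 g).trans ?_
    rw [← Finset.mul_sum]
    gcongr
    exact h a ha
  refine hs.trans ?_
  have hC0 : 0 < C := by linarith
  have hCp : C ≤ C ^ p := by
    calc C = C ^ (1 : ℝ) := (Real.rpow_one C).symm
      _ ≤ C ^ p := Real.rpow_le_rpow_of_exponent_le hC1 hp1
  have h3p : (3 : ℝ) ^ (d * e) ≤ ((3 : ℝ) ^ d) ^ p := by
    rw [← Real.rpow_natCast, ← Real.rpow_mul (by norm_num)]
    refine Real.rpow_le_rpow_of_exponent_le (by norm_num) ?_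
    rw [he]
    have : 0 ≤ (1 + 4 / d : ℝ) := by positivity
    gcongr
    linarith
  have hNp : (N : ℝ) ^ (d * e) * (N : ℝ) ^ (2 + ε)
      ≤ ((N : ℝ) ^ ((d : ℝ) / 2 - ((d : ℝ) + 2) / p + ε)) ^ p := by
    rw [← Real.rpow_mul hN0.le, ← Real.rpow_add hN0]
    refine Real.rpow_le_rpow_of_exponent_le hN1 ?_
    have h5 : ((d : ℝ) / 2 - ((d : ℝ) + 2) / p + ε) * p = d * p / 2 - (d + 2) + ε * p := by
      field_simp
    rw [h5, hde]
    nlinarith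
  calc (3 * N : ℝ) ^ (d * e) * (C * (N : ℝ) ^ (2 + ε) * Fintype.card ((Fin d → ZMod M) × ZMod M))
      = C * (3 : ℝ) ^ (d * e) * ((N : ℝ) ^ (d * e) * (N : ℝ) ^ (2 + ε)) * Fintype.card ((Fin d → ZMod M) × ZMod M) := by
        rw [Real.mul_rpow (by norm_num) hN0.le]; ring
    _ ≤ C ^ p * ((3 : ℝ) ^ d) ^ p *
        ((N : ℝ) ^ ((d : ℝ) / 2 - ((d : ℝ) + 2) / p + ε)) ^ p * Fintype.card ((Fin d → ZMod M) × ZMod M) := by gcongr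
    _ = _ := by
        rw [Real.mul_rpow (by positivity) (by positivity), Real.mul_rpow (by positivity)
          (by positivity)]

/-! ### Transference from the grid to the torus. -/

theorem UnitAddTorus.mFourier_apply_add {ι : Type*} [Fintype ι] (n : ι → ℤ) (x y : UnitAddTorus ι) :
    UnitAddTorus.mFourier n (x + y) = UnitAddTorus.mFourier n x * UnitAddTorus.mFourier n y := by
  simp [UnitAddTorus.mFourier, fourier_apply, smul_add, AddCircle.toCircle_add,
    Finset.prod_mul_distrib]

/-- The points of the grid `(ℤ/M)ᵈ⁺¹` inside the torus. -/
noncomputable def gridPoint {M : ℕ} [NeZero M] {d : ℕ} (g : (Fin d → ZMod M) × ZMod M) :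
    UnitAddTorus (Fin (d + 1)) :=
  Fin.snoc (α := fun _ => UnitAddCircle) (fun j => ZMod.toAddCircle (g.1 j)) (ZMod.toAddCircle g.2)

theorem fourier_toAddCircle {M : ℕ} [NeZero M] (m : ℤ) (x : ZMod M) :
    (fourier m (ZMod.toAddCircle x : UnitAddCircle) : ℂ) = ZMod.stdAddChar ((m : ZMod M) * x) := by
  rw [fourier_apply, ← map_zsmul, zsmul_eq_mul]
  rfl

theorem mFourier_gridPoint {M : ℕ} [NeZero M] {d : ℕ} (n : Fin d → ℤ)
    (g : (Fin d → ZMod M) × ZMod M) :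
    UnitAddTorus.mFourier (paraboloidPoint n) (gridPoint g) = paraboloidChar M n g := by
  rw [paraboloidChar_apply, AddChar.map_add_eq_mul, AddChar.map_sum_eq_prod]
  simp only [UnitAddTorus.mFourier, ContinuousMap.coe_mk]
  rw [Fin.prod_univ_castSucc]
  simp only [paraboloidPoint, gridPoint, Fin.snoc_castSucc, Fin.snoc_last, fourier_toAddCircle]
  push_cast
  rfl

theorem norm_mFourier_apply {ι : Type*} [Fintype ι] (n : ι → ℤ) (x : UnitAddTorus ι) :
    ‖UnitAddTorus.mFourier n x‖ = 1 := by
  simp only [UnitAddTorus.mFourier, ContinuousMap.coe_mk, fourier_apply, norm_prod,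
    Circle.norm_coe, Finset.prod_const_one]

instance (d : ℕ) : Measure.IsAddLeftInvariant (torusMeasure d) := by
  unfold torusMeasure; infer_instance

instance (d : ℕ) : IsProbabilityMeasure (torusMeasure d) := by
  unfold torusMeasure; infer_instance

theorem continuous_strichartzSum (d N : ℕ) (a : (Fin d → ℤ) → ℂ) :
    Continuous (strichartzSum d N a) := by
  unfold strichartzSum
  fun_prop

/-- Transference of a moment bound from the grid to the torus. -/
theorem lintegral_strichartzSum_le {d N M : ℕ} [NeZero M] {p B : ℝ} (hp : 0 < p) (hB : 0 ≤ B)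
    (h : ∀ a : (Fin d → ℤ) → ℂ, ∑ n ∈ freqBox d N, ‖a n‖ ^ 2 ≤ 1 →
      ∑ g, ‖∑ n ∈ freqBox d N, a n * paraboloidChar M n g‖ ^ p
        ≤ B ^ p * Fintype.card ((Fin d → ZMod M) × ZMod M))
    (a : (Fin d → ℤ) → ℂ) (ha : ∑ n ∈ freqBox d N, ‖a n‖ ^ 2 ≤ 1) :
    ∫⁻ z, ‖strichartzSum d N a z‖ₑ ^ p ∂(torusMeasure d) ≤ ENNReal.ofReal B ^ p := by
  set I := ∫⁻ z, ‖strichartzSum d N a z‖ₑ ^ p ∂(torusMeasure d) with hI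
  have hshift : ∀ g : (Fin d → ZMod M) × ZMod M,
      ∫⁻ z, ‖strichartzSum d N a (gridPoint g + z)‖ₑ ^ p ∂(torusMeasure d) = I := fun g =>
    lintegral_add_left_eq_self (fun z => ‖strichartzSum d N a z‖ₑ ^ p) (gridPoint g)
  have hmeas : ∀ g : (Fin d → ZMod M) × ZMod M,
      Measurable fun z => ‖strichartzSum d N a (gridPoint g + z)‖ₑ ^ p := fun g =>
    ((continuous_strichartzSum d N a).comp (continuous_const.add continuous_id)).measurable.enorm.pow_const p
  have hpt : ∀ z, ∑ g : (Fin d → ZMod M) × ZMod M, ‖strichartzSum d N a (gridPoint g + z)‖ₑ ^ p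
      ≤ ENNReal.ofReal B ^ p * Fintype.card ((Fin d → ZMod M) × ZMod M) := by
    intro z
    -- Translating the grid by `z` only multiplies the coefficients by unimodular numbers, so the
    -- grid bound holds on every translate.
    have h1 := h (fun n => a n * UnitAddTorus.mFourier (paraboloidPoint n) z) (by
      simpa [norm_mFourier_apply] using ha)
    have h2 : ∀ g : (Fin d → ZMod M) × ZMod M, strichartzSum d N a (gridPoint g + z)
        = ∑ n ∈ freqBox d N, a n * UnitAddTorus.mFourier (paraboloidPoint n) z
          * paraboloidChar M n g := by
      intro g
      unfold strichartzSum
      refine Finset.sum_congr rfl fun n _ => ?_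
      rw [UnitAddTorus.mFourier_apply_add, mFourier_gridPoint]
      ring
    simp_rw [h2]
    have h3 : ∀ w : ℂ, ‖w‖ₑ ^ p = ENNReal.ofReal (‖w‖ ^ p) := fun w => by
      rw [← ofReal_norm, ENNReal.ofReal_rpow_of_nonneg (norm_nonneg _) hp.le]
    simp_rw [h3]
    rw [← ENNReal.ofReal_sum_of_nonneg (fun _ _ => by positivity),
      ENNReal.ofReal_rpow_of_nonneg hB hp.le, ← ENNReal.ofReal_natCast,
      ← ENNReal.ofReal_mul (by positivity)]
    exact ENNReal.ofReal_le_ofReal h1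
  set G := (Fintype.card ((Fin d → ZMod M) × ZMod M) : ℝ≥0∞) with hG
  have hG0 : G ≠ 0 := by rw [hG]; exact_mod_cast Fintype.card_ne_zero
  have hGt : G ≠ ∞ := ENNReal.natCast_ne_top _
  have hsum : G * I ≤ G * ENNReal.ofReal B ^ p := by
    calc G * I = ∑ g : (Fin d → ZMod M) × ZMod M, I := by
          rw [Finset.sum_const, Finset.card_univ, nsmul_eq_mul]
      _ = ∫⁻ z, ∑ g : (Fin d → ZMod M) × ZMod M, ‖strichartzSum d N a (gridPoint g + z)‖ₑ ^ p
            ∂(torusMeasure d) := by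
          rw [lintegral_finsetSum _ fun g _ => hmeas g]
          exact Finset.sum_congr rfl fun g _ => (hshift g).symm
      _ ≤ ∫⁻ z, ENNReal.ofReal B ^ p * G ∂(torusMeasure d) := lintegral_mono hpt
      _ = G * ENNReal.ofReal B ^ p := by simp [mul_comm]
  exact (ENNReal.mul_le_mul_iff_right hG0 hGt).1 hsum

/-- Homogeneity removes the normalisation of the coefficients; a zero ℓ² norm, which cannot be
scaled to 1, is treated apart. -/
theorem eLpNorm_strichartzSum_le {d N : ℕ} {p B : ℝ} (hp : 0 < p)
    (h : ∀ a : (Fin d → ℤ) → ℂ, ∑ n ∈ freqBox d N, ‖a n‖ ^ 2 ≤ 1 →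
      ∫⁻ z, ‖strichartzSum d N a z‖ₑ ^ p ∂(torusMeasure d) ≤ ENNReal.ofReal B ^ p)
    (a : (Fin d → ℤ) → ℂ) :
    eLpNorm (strichartzSum d N a) (ENNReal.ofReal p) (torusMeasure d)
      ≤ ENNReal.ofReal B * (∑ n ∈ freqBox d N, ‖a n‖ₑ ^ 2) ^ (1 / 2 : ℝ) := by
  set σ : ℝ := Real.sqrt (∑ n ∈ freqBox d N, ‖a n‖ ^ 2) with hσ
  have hnn : 0 ≤ ∑ n ∈ freqBox d N, ‖a n‖ ^ 2 := by positivity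
  have hσe : (∑ n ∈ freqBox d N, ‖a n‖ₑ ^ 2) ^ (1 / 2 : ℝ) = ENNReal.ofReal σ := by
    have : ∑ n ∈ freqBox d N, ‖a n‖ₑ ^ 2 = ENNReal.ofReal (∑ n ∈ freqBox d N, ‖a n‖ ^ 2) := by
      rw [ENNReal.ofReal_sum_of_nonneg fun _ _ => by positivity]
      refine Finset.sum_congr rfl fun n _ => ?_
      rw [← ofReal_norm, ENNReal.ofReal_pow (norm_nonneg _)]
    rw [this, ENNReal.ofReal_rpow_of_nonneg hnn (by norm_num), hσ, Real.sqrt_eq_rpow]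
  rw [hσe]
  rcases (Real.sqrt_nonneg _ : 0 ≤ σ).eq_or_lt with h0 | hpos
  · have hz : ∀ n ∈ freqBox d N, a n = 0 := by
      have h1 := (Real.sqrt_eq_zero hnn).1 h0.symm
      intro n hn
      have := (Finset.sum_eq_zero_iff_of_nonneg fun _ _ => by positivity).1 h1 n hn
      simpa using this
    have : strichartzSum d N a = 0 := by
      funext z
      unfold strichartzSum
      exact Finset.sum_eq_zero fun n hn => by rw [hz n hn, zero_mul]
    rw [this]
    simp
  · set b : (Fin d → ℤ) → ℂ := fun n => (σ : ℂ)⁻¹ * a n with hb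
    have hσC : (σ : ℂ) ≠ 0 := by exact_mod_cast hpos.ne'
    have hb1 : ∑ n ∈ freqBox d N, ‖b n‖ ^ 2 ≤ 1 := by
      simp only [hb, norm_mul, norm_inv, Complex.norm_real, mul_pow, ← Finset.mul_sum]
      have hσ2 : σ ^ 2 = ∑ n ∈ freqBox d N, ‖a n‖ ^ 2 := Real.sq_sqrt hnn
      rw [Real.norm_of_nonneg hpos.le, inv_pow]
      exact (inv_mul_le_one₀ (pow_pos hpos 2)).2 hσ2.ge
    have hab : strichartzSum d N a = (σ : ℂ) • strichartzSum d N b := by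
      funext z
      simp only [strichartzSum, Pi.smul_apply, smul_eq_mul, Finset.mul_sum, hb]
      refine Finset.sum_congr rfl fun n _ => ?_
      rw [← mul_assoc, ← mul_assoc, mul_inv_cancel₀ hσC, one_mul]
    rw [hab, eLpNorm_const_smul, mul_comm]
    have hσn : ‖(σ : ℂ)‖ₑ = ENNReal.ofReal σ := by
      rw [← ofReal_norm, Complex.norm_real, Real.norm_of_nonneg hpos.le]
    rw [hσn]
    gcongr
    rw [eLpNorm_eq_lintegral_rpow_enorm_toReal (by simpa using hp) ENNReal.ofReal_ne_top,
      ENNReal.toReal_ofReal hp.le]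
    calc _ ≤ (ENNReal.ofReal B ^ p) ^ (1 / p) := by
          gcongr
          exact h b hb1
      _ = _ := by rw [← ENNReal.rpow_mul, mul_one_div_cancel hp.ne', ENNReal.rpow_one]

/-! ### Restriction by duality, and conclusion. -/

/-- Duality between the Strichartz estimate and the discrete restriction estimate. -/
theorem restrictionConst_le_sq {d N : ℕ} {p : ℝ} (hp : 1 < p) (K : ℝ≥0∞)
    (hK : ∀ a : (Fin d → ℤ) → ℂ,
      eLpNorm (strichartzSum d N a) (ENNReal.ofReal p) (torusMeasure d)
        ≤ K * (∑ n ∈ freqBox d N, ‖a n‖ₑ ^ 2) ^ (1 / 2 : ℝ)) :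
    restrictionConst p d N ≤ K ^ 2 := by
  refine sInf_le fun f hf => ?_
  have hpq : p.HolderConjugate (p / (p - 1)) := Real.HolderConjugate.conjExponent hp
  set p' := p / (p - 1) with hp'
  set b : (Fin d → ℤ) → ℂ := fun n => UnitAddTorus.mFourierCoeff f (paraboloidPoint n) with hb
  set X := ∑ n ∈ freqBox d N, ‖b n‖ₑ ^ 2 with hX
  have hfint : Integrable f (torusMeasure d) :=
    hf.integrable (by rw [← ENNReal.ofReal_one]; exact ENNReal.ofReal_le_ofReal hpq.symm.lt.le)
  have hcoef : ∀ n, b n = ∫ z, (starRingEnd ℂ) (UnitAddTorus.mFourier (paraboloidPoint n) z) * f z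
      ∂(torusMeasure d) := by
    intro n
    have : b n = ∫ z, UnitAddTorus.mFourier (-(paraboloidPoint n)) z • f z ∂(torusMeasure d) := rfl
    rw [this]
    simp only [UnitAddTorus.mFourier_neg, smul_eq_mul]
  have hint : ∀ n, Integrable (fun z => (starRingEnd ℂ) (b n) *
      ((starRingEnd ℂ) (UnitAddTorus.mFourier (paraboloidPoint n) z) * f z)) (torusMeasure d) := by
    intro n
    refine Integrable.const_mul ?_ _
    refine hfint.bdd_mul (c := 1) ?_ ?_
    · exact (Complex.continuous_conj.comp
        (UnitAddTorus.mFourier (paraboloidPoint n)).continuous).aestronglyMeasurable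
    · refine Filter.Eventually.of_forall fun z => ?_
      rw [RCLike.norm_conj, norm_mFourier_apply]
  have hsum : ((∑ n ∈ freqBox d N, ‖b n‖ ^ 2 : ℝ) : ℂ)
      = ∫ z, (starRingEnd ℂ) (strichartzSum d N b z) * f z ∂(torusMeasure d) := by
    have h1 : ∀ z, (starRingEnd ℂ) (strichartzSum d N b z) * f z = ∑ n ∈ freqBox d N,
        (starRingEnd ℂ) (b n) *
          ((starRingEnd ℂ) (UnitAddTorus.mFourier (paraboloidPoint n) z) * f z) := by
      intro z
      rw [strichartzSum, map_sum, Finset.sum_mul]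
      refine Finset.sum_congr rfl fun n _ => ?_
      rw [map_mul]
      ring
    simp_rw [h1]
    rw [integral_finsetSum _ fun n _ => hint n]
    push_cast
    refine Finset.sum_congr rfl fun n _ => ?_
    rw [integral_const_mul, ← hcoef, mul_comm, Complex.mul_conj, Complex.normSq_eq_norm_sq]
    push_cast
    rfl
  have hXeq : X = ‖((∑ n ∈ freqBox d N, ‖b n‖ ^ 2 : ℝ) : ℂ)‖ₑ := by
    rw [← ofReal_norm, Complex.norm_real, Real.norm_of_nonneg (by positivity),
      ENNReal.ofReal_sum_of_nonneg fun _ _ => by positivity]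
    refine Finset.sum_congr rfl fun n _ => ?_
    rw [← ofReal_norm, ENNReal.ofReal_pow (norm_nonneg _)]
  have hXtop : X ≠ ∞ := by rw [hXeq]; exact enorm_ne_top
  have hnorm : ∀ (g : UnitAddTorus (Fin (d + 1)) → ℂ) (r : ℝ), 0 < r →
      eLpNorm g (ENNReal.ofReal r) (torusMeasure d)
        = (∫⁻ z, ‖g z‖ₑ ^ r ∂(torusMeasure d)) ^ (1 / r) := by
    intro g r hr
    rw [eLpNorm_eq_lintegral_rpow_enorm_toReal (by simpa using hr) ENNReal.ofReal_ne_top,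
      ENNReal.toReal_ofReal hr.le]
  set F := eLpNorm f (ENNReal.ofReal p') (torusMeasure d) with hF
  -- The Strichartz bound is tested on the Fourier coefficients of `f` themselves. Dividing by `X ^
  -- (1 / 2)` below needs `X` to be finite and nonzero.
  have hXle : X ≤ K * X ^ (1 / 2 : ℝ) * F := by
    calc X ≤ ∫⁻ z, ‖(starRingEnd ℂ) (strichartzSum d N b z) * f z‖ₑ ∂(torusMeasure d) := by
          rw [hXeq, hsum]
          exact enorm_integral_le_lintegral_enorm _
      _ = ∫⁻ z, ((fun z => ‖strichartzSum d N b z‖ₑ) * fun z => ‖f z‖ₑ) z ∂(torusMeasure d) := by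
          refine lintegral_congr fun z => ?_
          rw [enorm_mul, Pi.mul_apply]
          congr 1
          rw [← ofReal_norm, RCLike.norm_conj, ofReal_norm]
      _ ≤ (∫⁻ z, ‖strichartzSum d N b z‖ₑ ^ p ∂(torusMeasure d)) ^ (1 / p)
          * (∫⁻ z, ‖f z‖ₑ ^ p' ∂(torusMeasure d)) ^ (1 / p') :=
          ENNReal.lintegral_mul_le_Lp_mul_Lq _ hpq
            (continuous_strichartzSum d N b).measurable.enorm.aemeasurable
            hf.aestronglyMeasurable.enorm
      _ = eLpNorm (strichartzSum d N b) (ENNReal.ofReal p) (torusMeasure d) * F := by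
          rw [hF, hnorm _ p hpq.pos, hnorm _ p' hpq.symm.pos]
      _ ≤ _ := by gcongr; exact hK b
  rcases eq_or_ne X 0 with h0 | h0
  · rw [h0]; positivity
  have hXh : X ^ (1 / 2 : ℝ) * X ^ (1 / 2 : ℝ) = X := by
    rw [← ENNReal.rpow_add _ _ h0 hXtop]; norm_num
  have hXh0 : X ^ (1 / 2 : ℝ) ≠ 0 := by
    intro h; rw [h, zero_mul] at hXh; exact h0 hXh.symm
  have hXht : X ^ (1 / 2 : ℝ) ≠ ∞ := ENNReal.rpow_ne_top_of_nonneg (by norm_num) hXtop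
  have hroot : X ^ (1 / 2 : ℝ) ≤ K * F := by
    refine (ENNReal.mul_le_mul_iff_right hXh0 hXht).1 ?_
    rw [hXh]
    calc X ≤ K * X ^ (1 / 2 : ℝ) * F := hXle
      _ = _ := by ring
  calc X = X ^ (1 / 2 : ℝ) * X ^ (1 / 2 : ℝ) := hXh.symm
    _ ≤ (K * F) * (K * F) := by gcongr
    _ = K ^ 2 * F ^ 2 := by ring

theorem exists_forall_eLpNorm_strichartzSum_le (d : ℕ) (hd : 1 ≤ d) {ε : ℝ} (hε : 0 < ε) :
    ∃ C : ℝ, 0 < C ∧ ∀ p : ℝ, 2 * ((d : ℝ) + 4) / d < p → 1 < p ∧ ∀ N : ℕ, 1 ≤ N →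
      ∀ a : (Fin d → ℤ) → ℂ,
      eLpNorm (strichartzSum d N a) (ENNReal.ofReal p) (torusMeasure d)
        ≤ ENNReal.ofReal (C * (N : ℝ) ^ ((d : ℝ) / 2 - ((d : ℝ) + 2) / p + ε))
          * (∑ n ∈ freqBox d N, ‖a n‖ₑ ^ 2) ^ (1 / 2 : ℝ) := by
  obtain ⟨C, hC0, hC⟩ := exists_grid_sum_norm_rpow_le d hd hε
  refine ⟨C, hC0, fun p hp => ?_⟩
  have hd0 : (0 : ℝ) < d := by exact_mod_cast hd
  have hp1 : 1 < p := by
    have : 1 ≤ 2 * ((d : ℝ) + 4) / d := by rw [le_div_iff₀ hd0]; linarith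
    linarith
  refine ⟨hp1, fun N hN a => ?_⟩
  obtain ⟨M, hM, h⟩ := hC p hp N hN
  exact eLpNorm_strichartzSum_le (by linarith)
    (lintegral_strichartzSum_le (by linarith) (by positivity) h) a

theorem corollary2 (d : ℕ) (hd : 1 ≤ d) (ε : ℝ) (hε : 0 < ε) :
    (∃ C : ℝ, 0 < C ∧ ∀ p : ℝ, 2 * ((d : ℝ) + 4) / d < p → ∀ N : ℕ, 1 ≤ N →
      strichartzConst p d N
        ≤ ENNReal.ofReal (C * (N : ℝ) ^ ((d : ℝ) / 2 - ((d : ℝ) + 2) / p + ε))) ∧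
    (∃ C : ℝ, 0 < C ∧ ∀ p : ℝ, 2 * ((d : ℝ) + 4) / d < p → ∀ N : ℕ, 1 ≤ N →
      restrictionConst p d N
        ≤ ENNReal.ofReal (C * (N : ℝ) ^ ((d : ℝ) - 2 * ((d : ℝ) + 2) / p + ε))) := by
  constructor
  · obtain ⟨C, hC0, hC⟩ := exists_forall_eLpNorm_strichartzSum_le d hd hε
    exact ⟨C, hC0, fun p hp N hN => sInf_le fun a => (hC p hp).2 N hN a⟩
  -- Half of ε, because the Strichartz constant gets squared.
  · obtain ⟨C, hC0, hC⟩ := exists_forall_eLpNorm_strichartzSum_le d hd (half_pos hε)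
    refine ⟨C ^ 2, by positivity, fun p hp N hN => ?_⟩
    refine (restrictionConst_le_sq (hC p hp).1 _ ((hC p hp).2 N hN)).trans (le_of_eq ?_)
    have hN0 : (0 : ℝ) < N := by exact_mod_cast hN
    rw [← ENNReal.ofReal_pow (by positivity), mul_pow, ← Real.rpow_natCast ((N : ℝ) ^ _),
      ← Real.rpow_mul hN0.le]
    congr 3
    push_cast
    ring
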